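/- Let $d\ge 1$. Let $\Gamma_0$ be the space of finite subsets of $\mathbb R^d$, topologised as the disjoint union over $n\ge 0$ of the quotient spaces of $n$-tuples of distinct points modulo permutations, and let $\Gamma_0^2:=\{(\eta^+,\eta^-)\in\Gamma_0\times\Gamma_0:\eta^+\cap\eta^-=\emptyset\}$, both with their Borel $\sigma$-algebras. Let $\lambda:=\sum_{n\ge 0}\frac1{n!}m^{(n)}$ be the Lebesgue--Poisson measure on $\Gamma_0$, where $m^{(n)}$ is the image of Lebesgue measure $dx_1\cdots dx_n$ under $(x_1,\dots,x_n)\mapsto\{x_1,\dots,x_n\}$ for $n\ge1$ and $m^{(0)}(\{\emptyset\})=1$, and let $\lambda^2:=\lambda\otimes\lambda$, regarded as a measure on $\Gamma_0^2$. Let $B_{\mathrm{bs}}(\Gamma_0^2)$ be the set of bounded measurable $G:\Gamma_0^2\to\mathbb R$ for which there are $N^\pm\in\mathbb N_0$ and bounded Borel sets $\Lambda^\pm\subset\mathbb R^d$ such that $G(\eta^+,\eta^-)=0$ unless $\eta^\pm\subset\Lambda^\pm$ and $|\eta^\pm|\le N^\pm$. For functions on $\Gamma_0^2$ put $$(KG)(\eta^+,\eta^-)=\sum_{\xi^+\subset\eta^+,\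 \xi^-\subset\eta^-}G(\xi^+,\xi^-),\qquad (K^{-1}F)(\eta^+,\eta^-)=\sum_{\xi^+\subset\eta^+,\ \xi^-\subset\eta^-}(-1)^{|\eta^+\setminus\xi^+|+|\eta^-\setminus\xi^-|}F(\xi^+,\xi^-).$$ Let $d^\pm,b^\pm:\mathbb R^d\times\Gamma_0^2\to[0,\infty)$ be measurable functions such that $d^\pm(\cdot,\eta^+,\eta^-)$ and $b^\pm(\cdot,\eta^+,\eta^-)$ are in $L^1_{\mathrm{loc}}(\mathbb R^d)$ for every $(\eta^+,\eta^-)\in\Gamma_0^2$. On $\Gamma_0^2$ let $L=L_++L_-$, where $$(L_+F)(\gamma^+,\gamma^-)=\sum_{x\in\gamma^+}d^+(x,\gamma^+\setminus x,\gamma^-)\bigl(F(\gamma^+\setminus x,\gamma^-)-F(\gamma^+,\gamma^-)\bigr)+\int_{\mathbb R^d}b^+(x,\gamma^+,\gamma^-)\bigl(F(\gamma^+\cup x,\gamma^-)-F(\gamma^+,\gamma^-)\bigr)dx,$$ $$(L_-F)(\gamma^+,\gamma^-)=\sum_{y\in\gamma^-}d^-(y,\gamma^+,\gamma^-\setminus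 y)\bigl(F(\gamma^+,\gamma^-\setminus y)-F(\gamma^+,\gamma^-)\bigr)+\int_{\mathbb R^d}b^-(y,\gamma^+,\gamma^-)\bigl(F(\gamma^+,\gamma^-\cup y)-F(\gamma^+,\gamma^-)\bigr)dy,$$ and let $\hat LG:=K^{-1}LKG$ for $G\in B_{\mathrm{bs}}(\Gamma_0^2)$. Put $$D^\pm(x,\xi^+,\xi^-,\eta^+,\eta^-):=\bigl(K^{-1}d^\pm(x,\cdot\cup\xi^+,\cdot\cup\xi^-)\bigr)(\eta^+,\eta^-),\qquad B^\pm(x,\xi^+,\xi^-,\eta^+,\eta^-):=\bigl(K^{-1}b^\pm(x,\cdot\cup\xi^+,\cdot\cup\xi^-)\bigr)(\eta^+,\eta^-).$$ (Throughout, a function on $\Gamma_0^2$ is read as $0$ at a pair of intersecting sets.) Assume that for all bounded Borel sets $\Lambda\subset\mathbb R^d$ and all $n,m\in\mathbb N_0$, with $\Gamma_\Lambda^{(n,m)}:=\{(\eta^+,\eta^-)\in\Gamma_0^2:\eta^\pm\subset\Lambda,\ |\eta^+|=n,\ |\eta^-|=m\}$, the two quantities $$A^+_{\Lambda,m,n}:=\int_{\Gamma_\Lambda^{(n,m)}}\sum_{\xi^\pm\subset\eta^\pm}\Bigl(\sum_{x\in\xi^+}\bigl|D^+(x,\xi^+\setminus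 x,\xi^-,\eta^+\setminus\xi^+,\eta^-\setminus\xi^-)\bigr|+\int_\Lambda\bigl|B^+(x,\xi^+,\xi^-,\eta^+\setminus\xi^+,\eta^-\setminus\xi^-)\bigr|dx\Bigr)d\lambda^2(\eta^+,\eta^-),$$ $$A^-_{\Lambda,m,n}:=\int_{\Gamma_\Lambda^{(n,m)}}\sum_{\xi^\pm\subset\eta^\pm}\Bigl(\sum_{y\in\xi^-}\bigl|D^-(y,\xi^+,\xi^-\setminus y,\eta^+\setminus\xi^+,\eta^-\setminus\xi^-)\bigr|+\int_\Lambda\bigl|B^-(y,\xi^+,\xi^-,\eta^+\setminus\xi^+,\eta^-\setminus\xi^-)\bigr|dy\Bigr)d\lambda^2(\eta^+,\eta^-)$$ are finite. For a function $k$ on $\Gamma_0^2$, a $\lambda^2$-a.e. measurable function $h$ is called a value of the dual operator $\hat L^*$ at $k$ if, for every $G\in B_{\mathrm{bs}}(\Gamma_0^2)$, the functions $(\hat LG)k$ and $Gh$ are $\lambda^2$-integrable and $\int(\hat LG)\,k\,d\lambda^2=\int G\,h\,d\lambda^2$. Then for each $k\in B_{\mathrm{bs}}(\Gamma_0^2)$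 such a value $\hat L^*k$ exists, it is unique up to $\lambda^2$-null sets, and, for $\lambda^2$-a.a. $(\eta^+,\eta^-)\in\Gamma_0^2$, $$\begin{aligned}(\hat L^*k)(\eta^+,\eta^-)=&-\sum_{x\in\eta^+}\int_{\Gamma_0^2}k(\eta^+\cup\xi^+,\eta^-\cup\xi^-)\,D^+(x,\eta^+\setminus x,\eta^-,\xi^+,\xi^-)\,d\lambda^2(\xi^+,\xi^-)\\&+\sum_{x\in\eta^+}\int_{\Gamma_0^2}k((\eta^+\setminus x)\cup\xi^+,\eta^-\cup\xi^-)\,B^+(x,\eta^+\setminus x,\eta^-,\xi^+,\xi^-)\,d\lambda^2(\xi^+,\xi^-)\\&-\sum_{y\in\eta^-}\int_{\Gamma_0^2}k(\eta^+\cup\xi^+,\eta^-\cup\xi^-)\,D^-(y,\eta^+,\eta^-\setminus y,\xi^+,\xi^-)\,d\lambda^2(\xi^+,\xi^-)\\&+\sum_{y\in\eta^-}\int_{\Gamma_0^2}k(\eta^+\cup\xi^+,(\eta^-\setminus y)\cup\xi^-)\,B^-(y,\eta^+,\eta^-\setminus y,\xi^+,\xi^-)\,d\lambda^2(\xi^+,\xi^-),\end{aligned}$$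 where for $\lambda^2$-a.a. $(\eta^+,\eta^-)$ all the integrands are $\lambda^2$-integrable. -/

import Mathlib

open MeasureTheory
open scoped ENNReal

noncomputable section

namespace TwoComp

/-! ## Finite configurations -/

/-- The underlying space `ℝ^d`. -/
abbrev Pt (d : ℕ) := EuclideanSpace ℝ (Fin d)

/-- The space `Γ₀` of finite configurations in `ℝ^d`. (A structure of its own, because Mathlib
puts another `σ`-algebra on `Finset`.) -/
@[ext]
structure FinConf (d : ℕ) where
  pts : Finset (Pt d)

variable {d : ℕ}

/-- Ordered `n`-tuples of pairwise distinct points. -/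
abbrev InjTuple (d n : ℕ) := {x : Fin n → Pt d // Function.Injective x}

/-- The map `(x₁, …, xₙ) ↦ {x₁, …, xₙ}`. -/
def ofTuple (n : ℕ) (x : InjTuple d n) : FinConf d :=
  ⟨Finset.univ.map ⟨x.1, x.2⟩⟩

/-- The disjoint union over `n` of the maps `(x₁, …, xₙ) ↦ {x₁, …, xₙ}`. -/
def ofSigma (p : Σ n, InjTuple d n) : FinConf d := ofTuple p.1 p.2

/-- The topology of `Γ₀`: the disjoint union over `n` of the quotient topologies on the
`n`-point configurations. -/
instance : TopologicalSpace (FinConf d) := TopologicalSpace.coinduced ofSigma inferInstance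

instance : MeasurableSpace (FinConf d) := borel _

instance : BorelSpace (FinConf d) := ⟨rfl⟩

/-- The space `Γ₀²` of pairs of disjoint finite configurations, with the topology and the
`σ`-algebra induced by the product `Γ₀ × Γ₀`; see `instBorelSpaceFinConf2` below. -/
abbrev FinConf2 (d : ℕ) :=
  {η : FinConf d × FinConf d // Disjoint η.1.pts η.2.pts}

/-- The `+` component. -/
abbrev FinConf2.plus (η : FinConf2 d) : Finset (Pt d) := η.1.1.pts

/-- The `-` component. -/
abbrev FinConf2.minus (η : FinConf2 d) : Finset (Pt d) := η.1.2.pts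

/-! ### Checks on the topology: the quotient map is open, the spaces are second countable, and
the `σ`-algebra of `Γ₀²` is its Borel `σ`-algebra. -/

theorem ofSigma_surjective : Function.Surjective (ofSigma (d := d)) := by
  intro η
  refine ⟨⟨η.pts.card, fun i => (η.pts.equivFin.symm i : Pt d), ?_⟩, ?_⟩
  · exact Subtype.val_injective.comp η.pts.equivFin.symm.injective
  · ext y
    simp only [ofSigma, ofTuple, Finset.mem_map, Finset.mem_univ, true_and,
      Function.Embedding.coeFn_mk]
    constructor
    · rintro ⟨i, rfl⟩
      exact (η.pts.equivFin.symm i).2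
    · intro hy
      exact ⟨η.pts.equivFin ⟨y, hy⟩, by simp⟩

theorem ofSigma_isQuotientMap : Topology.IsQuotientMap (ofSigma (d := d)) :=
  ⟨⟨rfl⟩, ofSigma_surjective⟩

theorem ofTuple_continuous (n : ℕ) : Continuous (ofTuple (d := d) n) :=
  ofSigma_isQuotientMap.continuous.comp continuous_sigmaMk

theorem ofTuple_eq_iff {n : ℕ} (x y : InjTuple d n) (h : ofTuple n x = ofTuple n y) :
    ∃ σ : Equiv.Perm (Fin n), x.1 ∘ σ = y.1 := by
  have hr : Set.range x.1 = Set.range y.1 := by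
    have := congrArg (fun c : FinConf d => (c.pts : Set (Pt d))) h
    simpa [ofTuple] using this
  refine ⟨(Equiv.ofInjective y.1 y.2).trans ((Equiv.setCongr hr.symm).trans
    (Equiv.ofInjective x.1 x.2).symm), ?_⟩
  funext i
  simp [Equiv.apply_ofInjective_symm x.2]

theorem ofSigma_isOpenMap : IsOpenMap (ofSigma (d := d)) := by
  intro U hU
  rw [← ofSigma_isQuotientMap.isOpen_preimage, isOpen_sigma_iff]
  intro n
  have hU' := isOpen_sigma_iff.1 hU n
  have : ((fun x : InjTuple d n => (⟨n, x⟩ : Σ n, InjTuple d n)) ⁻¹'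
      (ofSigma ⁻¹' (ofSigma '' U)) : Set (InjTuple d n)) =
      ⋃ σ : Equiv.Perm (Fin n),
        (fun x : InjTuple d n => (⟨x.1 ∘ σ, x.2.comp σ.injective⟩ : InjTuple d n)) ⁻¹'
          ((fun x : InjTuple d n => (⟨n, x⟩ : Σ n, InjTuple d n)) ⁻¹' U) := by
    ext x
    simp only [Set.mem_preimage, Set.mem_image, Set.mem_iUnion]
    constructor
    · rintro ⟨⟨m, y⟩, hy, hxy⟩
      have hm : m = n := by
        have := congrArg (fun c : FinConf d => c.pts.card) hxy
        simpa [ofSigma, ofTuple] using this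
      subst hm
      obtain ⟨σ, hσ⟩ := ofTuple_eq_iff x y hxy.symm
      refine ⟨σ, ?_⟩
      have : (⟨x.1 ∘ σ, x.2.comp σ.injective⟩ : InjTuple d m) = y := Subtype.ext hσ
      rw [this]; exact hy
    · rintro ⟨σ, hσ⟩
      refine ⟨_, hσ, ?_⟩
      ext z
      simp only [ofSigma, ofTuple, Finset.mem_map, Finset.mem_univ, true_and,
        Function.Embedding.coeFn_mk, Function.comp]
      exact ⟨fun ⟨i, hi⟩ => ⟨σ i, hi⟩, fun ⟨i, hi⟩ => ⟨σ.symm i, by simpa using hi⟩⟩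
  rw [this]
  refine isOpen_iUnion fun σ => hU'.preimage ?_
  refine Continuous.subtype_mk ?_ _
  exact continuous_pi fun i => (continuous_apply (σ i)).comp continuous_subtype_val

instance instSecondCountableFinConf : SecondCountableTopology (FinConf d) :=
  ofSigma_isQuotientMap.secondCountableTopology ofSigma_isOpenMap

instance instBorelSpaceFinConf2 : BorelSpace (FinConf2 d) := inferInstance

/-! ## The Lebesgue–Poisson measure -/

/-- The Lebesgue–Poisson measure `λ = ∑ₙ (1/n!) m⁽ⁿ⁾` on `Γ₀`, where `m⁽ⁿ⁾` is the image of
Lebesgue measure on the `n`-tuples of distinct points. (For `n = 0` the image is the unit mass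
at the empty configuration.) -/
def lebesguePoisson (d : ℕ) : Measure (FinConf d) :=
  Measure.sum fun n : ℕ =>
    ((n.factorial : ℝ≥0∞)⁻¹) •
      Measure.map (ofTuple n) ((volume : Measure (Fin n → Pt d)).comap Subtype.val)

/-- The product measure `λ² = λ ⊗ λ` on `Γ₀²`. -/
def lebesguePoisson2 (d : ℕ) : Measure (FinConf2 d) :=
  ((lebesguePoisson d).prod (lebesguePoisson d)).comap Subtype.val

/-! ## Functions on `Γ₀²` -/

open scoped Classical in
/-- The value `G(a, b)` of a function `G` on `Γ₀²`; it is set to `0` if `a` and `b` meet, that is,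
if `(a, b)` is not in `Γ₀²`. -/
def onPair (G : FinConf2 d → ℝ) (a b : Finset (Pt d)) : ℝ :=
  if h : Disjoint a b then G ⟨(⟨a⟩, ⟨b⟩), h⟩ else 0

/-- `Λ` is a bounded Borel set. -/
def IsBoundedBorel (Λ : Set (Pt d)) : Prop :=
  MeasurableSet Λ ∧ Bornology.IsBounded Λ

/-- The space `B_bs(Γ₀²)` of bounded measurable functions with bounded support. -/
structure IsBbs (G : FinConf2 d → ℝ) : Prop where
  measurable : Measurable G
  bounded : ∃ C : ℝ, ∀ η, |G η| ≤ C
  bounded_support : ∃ (Np Nm : ℕ) (Λp Λm : Set (Pt d)),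
    IsBoundedBorel Λp ∧ IsBoundedBorel Λm ∧
      ∀ η : FinConf2 d,
        ¬ (((η.plus : Set (Pt d)) ⊆ Λp ∧ η.plus.card ≤ Np) ∧
            ((η.minus : Set (Pt d)) ⊆ Λm ∧ η.minus.card ≤ Nm)) →
        G η = 0

/-- The restriction to `Γ₀²` of the `K`-transform of `G`. -/
def Ktrans (G : FinConf2 d → ℝ) (η : FinConf2 d) : ℝ :=
  ∑ a ∈ η.plus.powerset, ∑ b ∈ η.minus.powerset, onPair G a b

open scoped Classical in
/-- The inverse `K`-transform
`(K⁻¹F)(η⁺, η⁻) = ∑_{ξ⁺ ⊆ η⁺} ∑_{ξ⁻ ⊆ η⁻} (-1)^{|η⁺ \ ξ⁺| + |η⁻ \ ξ⁻|} F(ξ⁺, ξ⁻)`. -/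
def Kinv (F : FinConf2 d → ℝ) (η : FinConf2 d) : ℝ :=
  ∑ a ∈ η.plus.powerset, ∑ b ∈ η.minus.powerset,
    (-1 : ℝ) ^ ((η.plus \ a).card + (η.minus \ b).card) * onPair F a b

/-! ## Birth-and-death generator -/

/-- The standing assumptions on a birth or death rate: it is non-negative, measurable, and locally
integrable in the position `x ∈ ℝ^d`. -/
structure IsRate (r : Pt d → FinConf2 d → ℝ) : Prop where
  nonneg : ∀ x η, 0 ≤ r x η
  measurable : Measurable fun p : Pt d × FinConf2 d => r p.1 p.2
  locallyIntegrable : ∀ η, LocallyIntegrable (fun x => r x η) volume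

open scoped Classical in
/-- The generator `L₊` of births and deaths of `+` particles, evaluated on `Γ₀²`. -/
def genPlus (dp bp : Pt d → FinConf2 d → ℝ) (F : FinConf2 d → ℝ) (γ : FinConf2 d) : ℝ :=
  (∑ x ∈ γ.plus, onPair (dp x) (γ.plus.erase x) γ.minus *
      (onPair F (γ.plus.erase x) γ.minus - F γ)) +
    ∫ x : Pt d, bp x γ * (onPair F (insert x γ.plus) γ.minus - F γ)

open scoped Classical in
/-- The generator `L₋` of births and deaths of `-` particles, evaluated on `Γ₀²`. -/
def genMinus (dm bm : Pt d → FinConf2 d → ℝ) (F : FinConf2 d → ℝ) (γ : FinConf2 d) : ℝ :=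
  (∑ y ∈ γ.minus, onPair (dm y) γ.plus (γ.minus.erase y) *
      (onPair F γ.plus (γ.minus.erase y) - F γ)) +
    ∫ y : Pt d, bm y γ * (onPair F γ.plus (insert y γ.minus) - F γ)

/-- `L = L₊ + L₋`. -/
def gen (dp dm bp bm : Pt d → FinConf2 d → ℝ) (F : FinConf2 d → ℝ) (γ : FinConf2 d) : ℝ :=
  genPlus dp bp F γ + genMinus dm bm F γ

/-- `L̂ = K⁻¹ L K`. -/
def Lhat (dp dm bp bm : Pt d → FinConf2 d → ℝ) (G : FinConf2 d → ℝ) : FinConf2 d → ℝ :=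
  Kinv (gen dp dm bp bm (Ktrans G))

open scoped Classical in
/-- For a rate `r`, the function
`R(x, ξ⁺, ξ⁻, η⁺, η⁻) = (K⁻¹ r(x, · ∪ ξ⁺, · ∪ ξ⁻))(η⁺, η⁻)`; this is `D^±` for `r = d^±` and
`B^±` for `r = b^±`. -/
def rateK (r : Pt d → FinConf2 d → ℝ) (x : Pt d) (ξp ξm ηp ηm : Finset (Pt d)) : ℝ :=
  onPair (Kinv fun ζ : FinConf2 d => onPair (r x) (ζ.plus ∪ ξp) (ζ.minus ∪ ξm)) ηp ηm

/-- The set `Γ_Λ^{(n,m)}`. -/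
def confIn (Λ : Set (Pt d)) (n m : ℕ) : Set (FinConf2 d) :=
  {η | ((η.plus : Set (Pt d)) ⊆ Λ ∧ η.plus.card = n) ∧
    ((η.minus : Set (Pt d)) ⊆ Λ ∧ η.minus.card = m)}

open scoped Classical in
/-- The quantity `A⁺_{Λ,m,n}`. -/
def Aplus (dp bp : Pt d → FinConf2 d → ℝ) (Λ : Set (Pt d)) (m n : ℕ) : ℝ≥0∞ :=
  ∫⁻ η in confIn Λ n m, ∑ ξp ∈ η.plus.powerset, ∑ ξm ∈ η.minus.powerset,
    ((∑ x ∈ ξp, ‖rateK dp x (ξp.erase x) ξm (η.plus \ ξp) (η.minus \ ξm)‖ₑ) +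
      ∫⁻ x in Λ, ‖rateK bp x ξp ξm (η.plus \ ξp) (η.minus \ ξm)‖ₑ) ∂(lebesguePoisson2 d)

open scoped Classical in
/-- The quantity `A⁻_{Λ,m,n}`. -/
def Aminus (dm bm : Pt d → FinConf2 d → ℝ) (Λ : Set (Pt d)) (m n : ℕ) : ℝ≥0∞ :=
  ∫⁻ η in confIn Λ n m, ∑ ξp ∈ η.plus.powerset, ∑ ξm ∈ η.minus.powerset,
    ((∑ y ∈ ξm, ‖rateK dm y ξp (ξm.erase y) (η.plus \ ξp) (η.minus \ ξm)‖ₑ) +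
      ∫⁻ y in Λ, ‖rateK bm y ξp ξm (η.plus \ ξp) (η.minus \ ξm)‖ₑ) ∂(lebesguePoisson2 d)

/-! ## The dual operator -/

/-- `h` is a value of the dual operator `T*` at `k`, where `T` acts on `B_bs(Γ₀²)` and the pairing
is `∫ G k dλ²`: for all `G ∈ B_bs(Γ₀²)` both pairings are well defined, and
`∫ (T G) k dλ² = ∫ G h dλ²`. -/
def IsDualValue (T : (FinConf2 d → ℝ) → FinConf2 d → ℝ) (k h : FinConf2 d → ℝ) : Prop :=
  AEMeasurable h (lebesguePoisson2 d) ∧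
    ∀ G : FinConf2 d → ℝ, IsBbs G →
      Integrable (fun η => T G η * k η) (lebesguePoisson2 d) ∧
      Integrable (fun η => G η * h η) (lebesguePoisson2 d) ∧
      ∫ η, T G η * k η ∂(lebesguePoisson2 d) = ∫ η, G η * h η ∂(lebesguePoisson2 d)

/-! The four integrands, as functions of `ξ ∈ Γ₀²`, in the explicit formula for the dual. -/

open scoped Classical in
/-- `k(η⁺ ∪ ξ⁺, η⁻ ∪ ξ⁻) D⁺(x, η⁺ \ x, η⁻, ξ⁺, ξ⁻)` -/
def deathPlus (dp : Pt d → FinConf2 d → ℝ) (k : FinConf2 d → ℝ) (η : FinConf2 d) (x : Pt d)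
    (ξ : FinConf2 d) : ℝ :=
  onPair k (η.plus ∪ ξ.plus) (η.minus ∪ ξ.minus) *
    rateK dp x (η.plus.erase x) η.minus ξ.plus ξ.minus

open scoped Classical in
/-- `k((η⁺ \ x) ∪ ξ⁺, η⁻ ∪ ξ⁻) B⁺(x, η⁺ \ x, η⁻, ξ⁺, ξ⁻)` -/
def birthPlus (bp : Pt d → FinConf2 d → ℝ) (k : FinConf2 d → ℝ) (η : FinConf2 d) (x : Pt d)
    (ξ : FinConf2 d) : ℝ :=
  onPair k (η.plus.erase x ∪ ξ.plus) (η.minus ∪ ξ.minus) *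
    rateK bp x (η.plus.erase x) η.minus ξ.plus ξ.minus

open scoped Classical in
/-- `k(η⁺ ∪ ξ⁺, η⁻ ∪ ξ⁻) D⁻(y, η⁺, η⁻ \ y, ξ⁺, ξ⁻)` -/
def deathMinus (dm : Pt d → FinConf2 d → ℝ) (k : FinConf2 d → ℝ) (η : FinConf2 d) (y : Pt d)
    (ξ : FinConf2 d) : ℝ :=
  onPair k (η.plus ∪ ξ.plus) (η.minus ∪ ξ.minus) *
    rateK dm y η.plus (η.minus.erase y) ξ.plus ξ.minus

open scoped Classical in
/-- `k(η⁺ ∪ ξ⁺, (η⁻ \ y) ∪ ξ⁻) B⁻(y, η⁺, η⁻ \ y, ξ⁺, ξ⁻)` -/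
def birthMinus (bm : Pt d → FinConf2 d → ℝ) (k : FinConf2 d → ℝ) (η : FinConf2 d) (y : Pt d)
    (ξ : FinConf2 d) : ℝ :=
  onPair k (η.plus ∪ ξ.plus) (η.minus.erase y ∪ ξ.minus) *
    rateK bm y η.plus (η.minus.erase y) ξ.plus ξ.minus

/-- The right-hand side of the explicit formula for `L̂* k`. -/
def dualFormula (dp dm bp bm : Pt d → FinConf2 d → ℝ) (k : FinConf2 d → ℝ) (η : FinConf2 d) : ℝ :=
  -(∑ x ∈ η.plus, ∫ ξ, deathPlus dp k η x ξ ∂(lebesguePoisson2 d))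
    + (∑ x ∈ η.plus, ∫ ξ, birthPlus bp k η x ξ ∂(lebesguePoisson2 d))
    - (∑ y ∈ η.minus, ∫ ξ, deathMinus dm k η y ξ ∂(lebesguePoisson2 d))
    + (∑ y ∈ η.minus, ∫ ξ, birthMinus bm k η y ξ ∂(lebesguePoisson2 d))

end TwoComp

end

noncomputable section

namespace TwoComp

variable {d : ℕ}

open scoped Classical

/-! ## Measurability on `Γ₀` -/

/-! The proof has an algebraic half and a measure-theoretic half, and both concern only the `+` part
of the generator. The `-` part follows by exchanging the two components, which preserves $\lambda^2$
and $B_{\mathrm{bs}}$ and carries $L_-$ to an operator of the form $L_+$.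

Algebra. A death at $x$ changes $KG$ by minus the sum of $G(a,b)$ over the $a$ that contain $x$; a
birth at $x$ adds the terms $G(a\cup x,b)$. Möbius inversion around $(a\setminus x,b)$, respectively
$(a,b)$, expands the rate into a sum of values of $D^+$, respectively $B^+$, over subsets of what is
left of the configuration. Hence $L_+KG$ is itself a $K$-transform, and $K^{-1}$ cancels it: $\hat
L_+G(\eta)=\sum_{\xi\subset\eta}H(\xi,\eta\setminus\xi)$ with $H$ explicit (`Kinv_genPlus`).

Measure theory. The Minlos lemma turns
$\int\sum_{\xi\subset\eta}H(\xi,\eta\setminus\xi)\,d\lambda^2$ into a double integral over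
$(\xi,\zeta)$, and the Mecke formula turns a sum over the points of a configuration into an integral
over an additional point $x$. With their help $\int(\hat L_+G)k\,d\lambda^2$ and $\int
G\,h\,d\lambda^2$, where $h$ is the `+` part of the formula, both become integrals against
$dx\,\lambda^2(d\xi)\,\lambda^2(d\zeta)$ of the same functions: $G(\xi^+\cup x,\xi^-)$ times a death
or birth kernel built from $k$ and $D^+$ or $B^+$ (`integral_kernel_erase`, `integral_kernel_birth`,
`integral_mul_kernelSum`). Absolute convergence comes from $A^+<\infty$: read back on $\Gamma_0^2$,
the factor $k(\eta)$ confines $\eta$ to finitely many sets $\Gamma_\Lambda^{(n,m)}$.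

Pairs that intersect are $\lambda\otimes\lambda$-null since $d\ge1$, so integrals are computed on
the full product $\Gamma_0\times\Gamma_0$, functions being extended by zero. Uniqueness and almost
everywhere integrability follow by testing against a countable family of cut-offs in
$B_{\mathrm{bs}}$ that exhausts $\Gamma_0^2$. -/

/-- A configuration has only finitely many orderings, so its fibre in each stratum of tuples is
finite. Closed points and second countability make the Borel σ-algebra countably separated, as the
Lusin–Souslin argument in `exists_enum` requires. -/
theorem isClosed_singleton_finConf (c : FinConf d) : IsClosed ({c} : Set (FinConf d)) := by
  rw [← ofSigma_isQuotientMap.isClosed_preimage, isClosed_sigma_iff]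
  intro n
  refine Set.Finite.isClosed ?_
  refine Set.Finite.of_finite_image (f := Subtype.val) ?_ Subtype.val_injective.injOn
  refine (Set.Finite.pi (fun _ : Fin n => c.pts.finite_toSet)).subset ?_
  rintro _ ⟨x, hx, rfl⟩ i -
  have hx' : ofTuple n x = c := hx
  rw [← hx']
  simp [ofTuple]

instance : T1Space (FinConf d) := ⟨isClosed_singleton_finConf⟩

theorem measurable_card : Measurable fun η : FinConf d => η.pts.card := by
  refine Continuous.measurable ?_
  rw [ofSigma_isQuotientMap.continuous_iff, continuous_sigma_iff]
  intro n
  have : ((fun η : FinConf d => η.pts.card) ∘ ofSigma) ∘ Sigma.mk n =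
      fun _ : InjTuple d n => n := by
    funext x
    simp [ofSigma, ofTuple]
  exact (continuous_const (y := n)).congr fun x => (congrFun this x).symm

theorem measurableSet_injective (n : ℕ) :
    MeasurableSet {x : Fin n → Pt d | Function.Injective x} := by
  have : {x : Fin n → Pt d | Function.Injective x} =
      ⋂ (i : Fin n) (j : Fin n) (_ : i ≠ j), {x : Fin n → Pt d | x i = x j}ᶜ := by
    ext x
    simp only [Set.mem_ofPred_eq, Set.mem_iInter, Set.mem_compl_iff]
    exact ⟨fun h i j hij he => hij (h he), fun h i j he => by_contra fun hij => h i j hij he⟩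
  rw [this]
  refine MeasurableSet.iInter fun i => MeasurableSet.iInter fun j => MeasurableSet.iInter fun _ => ?_
  exact (measurableSet_eq_fun (measurable_pi_apply i) (measurable_pi_apply j)).compl

variable {X : Type*} [MeasurableSpace X]

/-- Reduces measurability to a fixed number of points, where sums and tuples have a fixed shape;
each `F n` is then defined and measurable on all of `X`, not only where `c x = n`. -/
theorem measurable_of_nat_cases {Y : Type*} [MeasurableSpace Y] {F : ℕ → X → Y} {c : X → ℕ}
    (hF : ∀ n, Measurable (F n)) (hc : Measurable c) : Measurable fun x => F (c x) x :=
  (measurable_from_prod_countable_right (f := fun q : ℕ × X => F q.1 q.2) hF).comp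
    (hc.prodMk measurable_id)

/-- A measurable enumeration of the points of a configuration. -/
theorem exists_enum (d : ℕ) : ∃ p : ℕ → FinConf d → Pt d, (∀ i, Measurable (p i)) ∧
    ∀ η : FinConf d, Set.InjOn (fun i => p i η) (Set.Iio η.pts.card) ∧
      (Finset.range η.pts.card).image (fun i => p i η) = η.pts := by
  -- The embedding in `ℝ` gives a Borel linear order of the points. Increasing tuples form a Borel
  -- set that contains exactly one ordering of each configuration, so `ψ n` is injective on a
  -- standard Borel space and hence a measurable embedding.
  obtain ⟨e, he⟩ := exists_measurableEmbedding_real (Pt d)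
  let S : ℕ → Type := fun n => {x : Fin n → Pt d // StrictMono (e ∘ x)}
  have hS : ∀ n, MeasurableSet {x : Fin n → Pt d | StrictMono (e ∘ x)} := by
    intro n
    have : {x : Fin n → Pt d | StrictMono (e ∘ x)} =
        ⋂ (i : Fin n) (j : Fin n) (_ : i < j), {x : Fin n → Pt d | e (x i) < e (x j)} := by
      ext x
      simp only [Set.mem_ofPred_eq, Set.mem_iInter]
      exact ⟨fun h i j hij => h hij, fun h i j hij => h i j hij⟩
    rw [this]
    refine MeasurableSet.iInter fun i => MeasurableSet.iInter fun j => MeasurableSet.iInter fun _ => ?_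
    exact measurableSet_lt (he.measurable.comp (measurable_pi_apply i))
      (he.measurable.comp (measurable_pi_apply j))
  have inst : ∀ n, StandardBorelSpace (S n) := fun n => (hS n).standardBorel
  let ψ : ∀ n, S n → FinConf d := fun n x => ofTuple n ⟨x.1, x.2.injective.of_comp⟩
  have hψm : ∀ n, Measurable (ψ n) := fun n =>
    (ofTuple_continuous n).measurable.comp (Measurable.subtype_mk measurable_subtype_coe)
  let _ : LinearOrder (Pt d) := LinearOrder.lift' e he.injective
  have hlt : ∀ a b : Pt d, a < b ↔ e a < e b := fun a b => Iff.rfl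
  have hψi : ∀ n, Function.Injective (ψ n) := by
    intro n x y h
    have hr : Set.range x.1 = Set.range y.1 := by
      have := congrArg (fun c : FinConf d => (c.pts : Set (Pt d))) h
      simpa [ψ, ofTuple] using this
    have hx : StrictMono x.1 := fun i j hij => (hlt _ _).2 (x.2 hij)
    have hy : StrictMono y.1 := fun i j hij => (hlt _ _).2 (y.2 hij)
    exact Subtype.ext ((StrictMono.range_inj hx hy).1 hr)
  have hψs : ∀ η : FinConf d, ∃ x, ψ η.pts.card x = η := by
    intro η
    refine ⟨⟨η.pts.orderEmbOfFin rfl, fun i j hij => ?_⟩, ?_⟩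
    · exact (hlt _ _).1 ((η.pts.orderEmbOfFin rfl).strictMono hij)
    · ext y
      have h1 := Set.ext_iff.1 (Finset.range_orderEmbOfFin η.pts rfl) y
      rw [Set.mem_range, Finset.mem_coe] at h1
      simpa only [ψ, ofTuple, Finset.mem_map, Finset.mem_univ, true_and,
        Function.Embedding.coeFn_mk] using h1
  -- The coordinates of the increasing tuple are carried over to the range of `ψ n` and extended
  -- measurably to all configurations; the value `0` for `i ≥ n` is never used.
  have key : ∀ n i : ℕ, ∃ g : FinConf d → Pt d, Measurable g ∧
      g ∘ ψ n = fun x : S n => if h : i < n then x.1 ⟨i, h⟩ else 0 := by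
    intro n i
    refine ((hψm n).measurableEmbedding (hψi n)).exists_measurable_extend ?_ fun _ => inferInstance
    by_cases h : i < n
    · simp only [h, dite_true]
      exact (measurable_pi_apply (⟨i, h⟩ : Fin n)).comp
        (measurable_subtype_coe (p := fun x : Fin n → Pt d => StrictMono (e ∘ x)))
    · simp [h]
  choose p hpm hp using key
  refine ⟨fun i η => p η.pts.card i η,
    fun i => measurable_of_nat_cases (F := fun n η => p n i η) (fun n => hpm n i) measurable_card,
    fun η => ?_⟩
  obtain ⟨x, hx⟩ := hψs η
  have hpv : ∀ i (h : i < η.pts.card), p η.pts.card i η = x.1 ⟨i, h⟩ := by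
    intro i h
    have := congrFun (hp η.pts.card i) x
    simpa [h, hx] using this
  constructor
  · intro i hi j hj hij
    simp only [Set.mem_Iio] at hi hj
    simp only [hpv i hi, hpv j hj] at hij
    simpa using x.2.injective.of_comp hij
  · have h1 : ∀ y, y ∈ η.pts ↔ ∃ i, x.1 i = y := by
      intro y
      conv_lhs => rw [← hx]
      simp [ψ, ofTuple]
    ext y
    rw [h1]
    simp only [Finset.mem_image, Finset.mem_range]
    constructor
    · rintro ⟨i, hi, rfl⟩
      exact ⟨⟨i, hi⟩, (hpv i hi).symm⟩
    · rintro ⟨i, rfl⟩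
      exact ⟨i, i.2, hpv i i.2⟩


/-- With a measurable enumeration the sum runs over the indices below the number of points, and that
number can be held fixed. -/
theorem measurable_sum_pts {E : Type*} [MeasurableSpace E] [AddCommMonoid E] [MeasurableAdd₂ E]
    {h : X × Pt d → E} (hh : Measurable h) {g : X → FinConf d} (hg : Measurable g) :
    Measurable fun x => ∑ y ∈ (g x).pts, h (x, y) := by
  obtain ⟨p, hp, hpη⟩ := exists_enum d
  have : (fun x => ∑ y ∈ (g x).pts, h (x, y)) =
      fun x => (fun n x => ∑ i ∈ Finset.range n, h (x, p i (g x))) (g x).pts.card x := by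
    funext x
    conv_lhs => rw [← (hpη (g x)).2]
    rw [Finset.sum_image]
    intro i hi j hj hij
    exact (hpη (g x)).1 (by simpa using hi) (by simpa using hj) hij
  rw [this]
  refine measurable_of_nat_cases (F := fun n x => ∑ i ∈ Finset.range n, h (x, p i (g x)))
    (fun n => ?_) (measurable_card.comp hg)
  refine Finset.measurable_sum (f := fun i x => h (x, p i (g x))) _ fun i _ => ?_
  exact hh.comp (measurable_id.prodMk ((hp i).comp hg))

theorem measurableSet_mem {f : X → Pt d} {g : X → FinConf d} (hf : Measurable f)
    (hg : Measurable g) : MeasurableSet {x | f x ∈ (g x).pts} := by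
  have h1 : Measurable fun q : X × Pt d => if q.2 = f q.1 then (1 : ℕ) else 0 :=
    Measurable.ite (measurableSet_eq_fun measurable_snd (hf.comp measurable_fst))
      measurable_const measurable_const
  have h2 := measurable_sum_pts h1 hg
  have : {x | f x ∈ (g x).pts} =
      (fun x => ∑ y ∈ (g x).pts, if y = f x then (1 : ℕ) else 0) ⁻¹' {0}ᶜ := by
    ext x
    simp
  rw [this]
  exact h2 (measurableSet_singleton _).compl

theorem measurable_insert {f : X → Pt d} {g : X → FinConf d} (hf : Measurable f)
    (hg : Measurable g) : Measurable fun x => (⟨insert (f x) (g x).pts⟩ : FinConf d) := by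
  obtain ⟨p, hp, hpη⟩ := exists_enum d
  -- `ofTuple` accepts only injective tuples, whereas for fixed `n` the enumerated tuple must be fed
  -- in at every `x`; a measurable extension bridges the gap, and its values off the injective
  -- tuples do not matter.
  have hT : ∀ n, ∃ T : (Fin n → Pt d) → FinConf d, Measurable T ∧
      T ∘ (Subtype.val : InjTuple d n → _) = ofTuple n := fun n =>
    (MeasurableEmbedding.subtype_coe (measurableSet_injective n)).exists_measurable_extend
      (ofTuple_continuous n).measurable fun _ => ⟨⟨∅⟩⟩
  choose T hTm hT using hT
  have : (fun x => (⟨insert (f x) (g x).pts⟩ : FinConf d)) = fun x =>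
      if f x ∈ (g x).pts then g x else
        (fun n x => T (n + 1) (Fin.cons (f x) fun i => p i (g x))) (g x).pts.card x := by
    funext x
    split_ifs with h
    · ext1; exact Finset.insert_eq_of_mem h
    · obtain ⟨h1, h2⟩ := hpη (g x)
      have hi : Function.Injective
          (Fin.cons (f x) (fun i => p i (g x)) : Fin ((g x).pts.card + 1) → Pt d) := by
        refine Fin.cons_injective_iff.2 ⟨?_, fun i j hij => ?_⟩
        · rintro ⟨i, hi⟩
          apply h
          rw [← h2, ← hi]
          exact Finset.mem_image_of_mem _ (by simp)
        · exact Fin.ext (h1 (by simp) (by simp) hij)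
      have := congrFun (hT ((g x).pts.card + 1)) ⟨_, hi⟩
      simp only [Function.comp] at this
      beta_reduce
      rw [this]
      ext y
      conv_lhs => rw [← h2]
      simp only [ofTuple, Finset.mem_insert, Finset.mem_image, Finset.mem_range, Finset.mem_map,
        Finset.mem_univ, true_and, Function.Embedding.coeFn_mk, Fin.exists_fin_succ, Fin.cons_zero,
        Fin.cons_succ, eq_comm (a := y)]
      refine or_congr Iff.rfl ⟨?_, ?_⟩
      · rintro ⟨i, hi, hy⟩; exact ⟨⟨i, hi⟩, hy⟩
      · rintro ⟨i, hy⟩; exact ⟨i, i.2, hy⟩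
  rw [this]
  refine Measurable.ite (measurableSet_mem hf hg) hg
    (measurable_of_nat_cases (F := fun n x => T (n + 1) (Fin.cons (f x) fun i => p i (g x)))
      (fun n => (hTm (n + 1)).comp ?_) (measurable_card.comp hg))
  refine measurable_pi_iff.2 fun i => ?_
  refine Fin.cases ?_ (fun j => ?_) i
  · simpa using hf
  · simp only [Fin.cons_succ]
    exact (hp j).comp hg

theorem measurable_image {ι : Type*} {p : ι → X → Pt d} (hp : ∀ i, Measurable (p i))
    (I : Finset ι) : Measurable fun x => (⟨I.image fun i => p i x⟩ : FinConf d) := by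
  induction I using Finset.induction_on with
  | empty => simp
  | insert i I _ ih => simpa [Finset.image_insert] using measurable_insert (hp i) ih

/-- The enumerated points that satisfy `A x` are inserted one at a time. Union, filter, difference
and erasure are all obtained from this one statement. -/
theorem measurable_union_filter {g g' : X → FinConf d} (hg : Measurable g) (hg' : Measurable g')
    {A : X → Pt d → Prop} (hA : MeasurableSet {q : X × Pt d | A q.1 q.2}) :
    Measurable fun x => (⟨(g x).pts.filter (A x) ∪ (g' x).pts⟩ : FinConf d) := by
  obtain ⟨p, hp, hpη⟩ := exists_enum d
  have hn : ∀ n, Measurable fun x => (⟨((Finset.range n).image fun i => p i (g x)).filter (A x) ∪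
      (g' x).pts⟩ : FinConf d) := by
    intro n
    induction n with
    | zero => simpa using hg'
    | succ n ih =>
      have hpn : Measurable fun x => p n (g x) := (hp n).comp hg
      convert Measurable.ite (p := fun x => A x (p n (g x))) (hA.preimage
        (measurable_id.prodMk hpn)) (measurable_insert hpn ih) ih using 1
      funext x
      rw [Finset.range_add_one, Finset.image_insert, Finset.filter_insert]
      split_ifs with h
      · ext1; simp [Finset.insert_union]
      · rfl
      · infer_instance
  have := measurable_of_nat_cases hn (measurable_card.comp hg)
  simpa only [Function.comp, (hpη (g _)).2] using this

theorem measurable_union {g g' : X → FinConf d} (hg : Measurable g) (hg' : Measurable g') :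
    Measurable fun x => (⟨(g x).pts ∪ (g' x).pts⟩ : FinConf d) := by
  simpa using measurable_union_filter hg hg' (A := fun _ _ => True) (by simp)

theorem measurable_filter {g : X → FinConf d} (hg : Measurable g)
    {A : X → Pt d → Prop} (hA : MeasurableSet {q : X × Pt d | A q.1 q.2}) :
    Measurable fun x => (⟨(g x).pts.filter (A x)⟩ : FinConf d) := by
  simpa using measurable_union_filter hg (g' := fun _ => ⟨∅⟩) measurable_const hA

theorem measurable_sdiff {g g' : X → FinConf d} (hg : Measurable g) (hg' : Measurable g') :
    Measurable fun x => (⟨(g x).pts \ (g' x).pts⟩ : FinConf d) := by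
  have := measurable_filter hg (A := fun x y => y ∉ (g' x).pts)
    (measurableSet_mem measurable_snd (hg'.comp measurable_fst)).compl
  convert this using 2
  ext
  simp

theorem measurable_erase {f : X → Pt d} {g : X → FinConf d} (hf : Measurable f)
    (hg : Measurable g) : Measurable fun x => (⟨(g x).pts.erase (f x)⟩ : FinConf d) := by
  have := measurable_filter hg (A := fun x y => y ≠ f x)
    (measurableSet_eq_fun measurable_snd (hf.comp measurable_fst)).compl
  convert this using 2
  ext1
  simp [Finset.filter_ne']

/-- Through the enumeration, subsets of the configuration correspond to sets of indices, over which
the sum has a fixed range. -/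
theorem measurable_sum_powerset {E : Type*} [MeasurableSpace E] [AddCommMonoid E]
    [MeasurableAdd₂ E] {h : X × FinConf d → E} (hh : Measurable h) {g : X → FinConf d}
    (hg : Measurable g) : Measurable fun x => ∑ a ∈ (g x).pts.powerset, h (x, ⟨a⟩) := by
  obtain ⟨p, hp, hpη⟩ := exists_enum d
  have hI := fun I : Finset ℕ => measurable_image (p := fun i x => p i (g x))
    (fun i => (hp i).comp hg) I
  have : (fun x => ∑ a ∈ (g x).pts.powerset, h (x, ⟨a⟩)) = fun x =>
      (fun n x => ∑ I ∈ (Finset.range n).powerset, h (x, ⟨I.image fun i => p i (g x)⟩))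
        (g x).pts.card x := by
    funext x
    have hinj := (hpη (g x)).1
    conv_lhs => rw [← (hpη (g x)).2]
    rw [Finset.powerset_image, Finset.sum_image]
    intro I hI J hJ hIJ
    have hI' : (I : Set ℕ) ⊆ Set.Iio (g x).pts.card := fun i hi => by
      simpa using Finset.mem_powerset.1 hI hi
    have hJ' : (J : Set ℕ) ⊆ Set.Iio (g x).pts.card := fun i hi => by
      simpa using Finset.mem_powerset.1 hJ hi
    have h' := congrArg (fun s : Finset (Pt d) => (s : Set (Pt d))) hIJ
    simp only [Finset.coe_image] at h'
    exact Finset.coe_injective ((hinj.image_eq_image_iff hI' hJ').1 h')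
  rw [this]
  refine measurable_of_nat_cases (F := fun n x => ∑ I ∈ (Finset.range n).powerset,
    h (x, ⟨I.image fun i => p i (g x)⟩)) (fun n => ?_) (measurable_card.comp hg)
  refine Finset.measurable_sum (f := fun I x => h (x, ⟨Finset.image (fun i => p i (g x)) I⟩)) _
    fun I _ => ?_
  exact hh.comp (measurable_id.prodMk (hI I))

theorem measurableSet_disjoint {g g' : X → FinConf d} (hg : Measurable g) (hg' : Measurable g') :
    MeasurableSet {x | Disjoint (g x).pts (g' x).pts} := by
  have h1 := measurable_card.comp (measurable_filter hg (A := fun x y => y ∈ (g' x).pts)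
    (measurableSet_mem measurable_snd (hg'.comp measurable_fst)))
  convert h1 (measurableSet_singleton 0) using 1
  ext x
  simp [Finset.disjoint_left, Finset.filter_eq_empty_iff]

theorem measurableSet_subset {g : X → FinConf d} (hg : Measurable g) {Λ : Set (Pt d)}
    (hΛ : MeasurableSet Λ) : MeasurableSet {x | ((g x).pts : Set (Pt d)) ⊆ Λ} := by
  have h1 := measurable_card.comp (measurable_filter hg (A := fun _ y => y ∉ Λ)
    (measurable_snd hΛ).compl)
  convert h1 (measurableSet_singleton 0) using 1
  ext x
  simp [Set.subset_def, Finset.filter_eq_empty_iff]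

/-- The set of disjoint pairs, as a subset of `Γ₀ × Γ₀`. -/
theorem measurableSet_disjointPairs :
    MeasurableSet {η : FinConf d × FinConf d | Disjoint η.1.pts η.2.pts} :=
  measurableSet_disjoint measurable_fst measurable_snd

theorem measurable_onPair_param {r : X → FinConf2 d → ℝ}
    (hr : Measurable fun p : X × FinConf2 d => r p.1 p.2) :
    Measurable fun p : X × FinConf d × FinConf d => onPair (r p.1) p.2.1.pts p.2.2.pts := by
  have hD : MeasurableSet {p : X × FinConf d × FinConf d | Disjoint p.2.1.pts p.2.2.pts} :=
    measurable_snd measurableSet_disjointPairs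
  have h1 : Measurable fun p : {p : X × FinConf d × FinConf d // Disjoint p.2.1.pts p.2.2.pts} =>
      r p.1.1 ⟨p.1.2, p.2⟩ :=
    hr.comp ((measurable_fst.comp measurable_subtype_coe).prodMk
      ((measurable_snd.comp measurable_subtype_coe).subtype_mk))
  exact Measurable.dite (s := {p : X × FinConf d × FinConf d | Disjoint p.2.1.pts p.2.2.pts}) h1
    (g := fun _ => 0) measurable_const hD

theorem measurable_onPair {G : FinConf2 d → ℝ} (hG : Measurable G) {g g' : X → FinConf d}
    (hg : Measurable g) (hg' : Measurable g') :
    Measurable fun x => onPair G (g x).pts (g' x).pts :=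
  (measurable_onPair_param (r := fun _ : Unit => G) (hG.comp measurable_snd)).comp
    ((measurable_const (a := ())).prodMk (hg.prodMk hg'))

/-! ## Integration with respect to the Lebesgue–Poisson measure -/

/-- The set of the entries of a tuple. -/
def imageConf (n : ℕ) (x : Fin n → Pt d) : FinConf d := ⟨Finset.univ.image x⟩

theorem measurable_imageConf (n : ℕ) : Measurable (imageConf (d := d) n) :=
  measurable_image (p := fun i (x : Fin n → Pt d) => x i) (fun i => measurable_pi_apply i) _

/-- Moves the measure from the subtype of injective tuples to the full product space, where Fubini
is available. -/
theorem lebesguePoisson_eq_restrict : lebesguePoisson d = Measure.sum fun n : ℕ =>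
    ((n.factorial : ℝ≥0∞)⁻¹) • Measure.map (imageConf n)
      ((volume : Measure (Fin n → Pt d)).restrict {x | Function.Injective x}) := by
  unfold lebesguePoisson
  congr 1
  funext n
  have h : (ofTuple n : InjTuple d n → FinConf d) = imageConf n ∘ Subtype.val := by
    funext x
    ext y
    simp [ofTuple, imageConf]
  rw [h, ← Measure.map_map (measurable_imageConf n) measurable_subtype_coe]
  congr 2
  exact map_comap_subtype_coe (measurableSet_injective n) _

instance : SFinite (lebesguePoisson d) := by
  rw [lebesguePoisson_eq_restrict]
  infer_instance

theorem volume_eq_apply (hd : 1 ≤ d) {n : ℕ} {i j : Fin n} (hij : i ≠ j) :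
    volume {x : Fin n → Pt d | x i = x j} = 0 := by
  -- The coincidence set is a linear subspace. It is proper because a nonzero vector in slot `i`
  -- with zeros elsewhere lies outside it; such a vector exists since `d ≥ 1`.
  let S : Submodule ℝ (Fin n → Pt d) :=
    LinearMap.ker (LinearMap.proj (R := ℝ) (φ := fun _ : Fin n => Pt d) i - LinearMap.proj j)
  have hS : {x : Fin n → Pt d | x i = x j} = S := by
    ext x
    simp [S, sub_eq_zero]
  rw [hS]
  refine Measure.addHaar_submodule _ S fun htop => ?_
  have hne : Nonempty (Fin d) := ⟨⟨0, hd⟩⟩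
  obtain ⟨v, hv⟩ := exists_ne (0 : Pt d)
  have : Pi.single i v ∈ S := htop ▸ Submodule.mem_top
  have h2 : Pi.single (M := fun _ : Fin n => Pt d) i v i = Pi.single (M := fun _ => Pt d) i v j := by
    simpa [S, sub_eq_zero] using this
  rw [Pi.single_eq_same, Pi.single_eq_of_ne hij.symm] at h2
  exact hv h2

theorem ae_injective (hd : 1 ≤ d) (n : ℕ) :
    ∀ᵐ x : Fin n → Pt d, Function.Injective x := by
  have : ∀ᵐ x : Fin n → Pt d, ∀ i j, i ≠ j → x i ≠ x j := by
    rw [ae_all_iff]; intro i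
    rw [ae_all_iff]; intro j
    by_cases hij : i = j
    · simp [hij]
    · have := volume_eq_apply hd hij
      filter_upwards [measure_eq_zero_iff_ae_notMem.1 this] with x hx _ using hx
  filter_upwards [this] with x hx i j hij
  exact by_contra fun h => hx i j h hij

theorem lintegral_lebesguePoisson (hd : 1 ≤ d) {F : FinConf d → ℝ≥0∞} (hF : Measurable F) :
    ∫⁻ η, F η ∂lebesguePoisson d =
      ∑' n : ℕ, (n.factorial : ℝ≥0∞)⁻¹ * ∫⁻ x : Fin n → Pt d, F (imageConf n x) := by
  rw [lebesguePoisson_eq_restrict, lintegral_sum_measure]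
  congr 1
  funext n
  rw [lintegral_smul_measure, lintegral_map hF (measurable_imageConf n),
    Measure.restrict_eq_self_of_ae_mem (s := {x | Function.Injective x}) (ae_injective hd n), smul_eq_mul]

/-- The Mecke formula. -/
theorem lintegral_mecke (hd : 1 ≤ d) {f : Pt d × FinConf d → ℝ≥0∞} (hf : Measurable f) :
    ∫⁻ η, ∑ x ∈ η.pts, f (x, ⟨η.pts.erase x⟩) ∂lebesguePoisson d =
      ∫⁻ x, ∫⁻ η, f (x, η) ∂lebesguePoisson d := by
  have hm : Measurable fun η : FinConf d => ∑ x ∈ η.pts, f (x, ⟨η.pts.erase x⟩) :=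
    measurable_sum_pts (h := fun q : FinConf d × Pt d => f (q.2, ⟨q.1.pts.erase q.2⟩))
      (hf.comp (measurable_snd.prodMk (measurable_erase measurable_snd measurable_fst)))
      measurable_id
  have hfi : ∀ n, Measurable fun p : Pt d × (Fin n → Pt d) => f (p.1, imageConf n p.2) := fun n =>
    hf.comp (measurable_fst.prodMk ((measurable_imageConf n).comp measurable_snd))
  -- Almost every tuple is injective, so the sum over points is a sum over coordinates. Splitting
  -- off any one of the `n + 1` coordinates gives the same integral.
  have hterm : ∀ n : ℕ, ∫⁻ x : Fin (n + 1) → Pt d, ∑ y ∈ (imageConf (n + 1) x).pts,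
      f (y, ⟨(imageConf (n + 1) x).pts.erase y⟩) =
      (n + 1 : ℕ) * ∫⁻ y, ∫⁻ z : Fin n → Pt d, f (y, imageConf n z) := by
    intro n
    have h1 : ∀ᵐ x : Fin (n + 1) → Pt d, ∑ y ∈ (imageConf (n + 1) x).pts,
        f (y, ⟨(imageConf (n + 1) x).pts.erase y⟩) =
        ∑ i : Fin (n + 1), f (x i, imageConf n (i.removeNth x)) := by
      filter_upwards [ae_injective hd (n + 1)] with x hx
      simp only [imageConf]
      rw [Finset.sum_image hx.injOn]
      refine Finset.sum_congr rfl fun i _ => ?_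
      congr 3
      ext y
      simp only [Finset.mem_erase, Finset.mem_image, Finset.mem_univ, true_and, Fin.removeNth]
      constructor
      · rintro ⟨hy, j, rfl⟩
        obtain ⟨l, rfl⟩ := Fin.exists_succAbove_eq (x := j) (y := i) (fun h => hy (h ▸ rfl))
        exact ⟨l, rfl⟩
      · rintro ⟨l, rfl⟩
        exact ⟨fun h => Fin.succAbove_ne i l (hx h), _, rfl⟩
    rw [lintegral_congr_ae h1, lintegral_finsetSum]
    · have h2 : ∀ i : Fin (n + 1),
          ∫⁻ x : Fin (n + 1) → Pt d, f (x i, imageConf n (i.removeNth x)) =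
          ∫⁻ y, ∫⁻ z : Fin n → Pt d, f (y, imageConf n z) := by
        intro i
        have hp := volume_preserving_piFinSuccAbove (fun _ : Fin (n + 1) => Pt d) i
        have := hp.lintegral_comp (hfi n)
        rw [Measure.volume_eq_prod, lintegral_prod _ (hfi n).aemeasurable] at this
        exact this
      simp only [h2, Finset.sum_const, Finset.card_univ, Fintype.card_fin, nsmul_eq_mul]
    · intro i _
      have hp := (MeasurableEquiv.piFinSuccAbove (fun _ : Fin (n + 1) => Pt d) i).measurable
      exact (hfi n).comp hp
  -- The empty configuration has no point to mark, so the series loses its term of index zero and is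
  -- shifted by one.
  rw [lintegral_lebesguePoisson hd hm, tsum_eq_zero_add' ENNReal.summable]
  have hrhs : ∀ x : Pt d, ∫⁻ η, f (x, η) ∂lebesguePoisson d = ∑' n : ℕ, (n.factorial : ℝ≥0∞)⁻¹ *
      ∫⁻ z : Fin n → Pt d, f (x, imageConf n z) := fun x =>
    lintegral_lebesguePoisson hd (hf.comp measurable_prodMk_left)
  simp only [hrhs]
  rw [lintegral_tsum]
  · have h0 : ∀ x : Fin 0 → Pt d, ∑ y ∈ (imageConf 0 x).pts,
        f (y, ⟨(imageConf 0 x).pts.erase y⟩) = 0 := by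
      intro x
      simp [imageConf]
    simp only [h0, lintegral_zero, mul_zero, zero_add, hterm]
    congr 1
    funext n
    rw [lintegral_const_mul _ (hfi n).lintegral_prod_right', ← mul_assoc]
    congr 1
    -- The `n + 1` equal contributions turn `1/(n+1)!` into `1/n!`.
    rw [Nat.factorial_succ, Nat.cast_mul, ENNReal.mul_inv (by simp) (by simp), mul_assoc, mul_comm,
      mul_assoc, ENNReal.mul_inv_cancel (by simp) (by simp), mul_one]
  · intro n
    exact ((hfi n).lintegral_prod_right'.const_mul _).aemeasurable

/-! ### Coincidences between components are null -/

/-- By the Mecke formula the integral of the number of points in `s` is an integral over `x ∈ s`,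
which vanishes because a finite set is Lebesgue-null. -/
theorem ae_disjoint_finset (hd : 1 ≤ d) (s : Finset (Pt d)) :
    ∀ᵐ η ∂lebesguePoisson d, Disjoint η.pts s := by
  have hne : Nonempty (Fin d) := ⟨⟨0, hd⟩⟩
  have hm : Measurable fun p : Pt d × FinConf d => if p.1 ∈ s then (1 : ℝ≥0∞) else 0 :=
    Measurable.ite (measurable_fst s.measurableSet) measurable_const measurable_const
  have h := lintegral_mecke hd hm
  have h0 : ∫⁻ x : Pt d, ∫⁻ _ : FinConf d, (if x ∈ s then (1 : ℝ≥0∞) else 0) ∂lebesguePoisson d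
      = 0 := by
    rw [← lintegral_zero (μ := (volume : Measure (Pt d)))]
    refine lintegral_congr_ae ?_
    have : ∀ᵐ x : Pt d, x ∉ s :=
      measure_eq_zero_iff_ae_notMem.1 (s.finite_toSet.measure_zero volume)
    filter_upwards [this] with x hx
    simp [hx]
  rw [h0] at h
  have hm' := measurable_sum_pts (X := FinConf d) (h := fun q => if q.2 ∈ s then (1 : ℝ≥0∞) else 0)
    (Measurable.ite (measurable_snd s.measurableSet) measurable_const measurable_const)
    measurable_id
  filter_upwards [(lintegral_eq_zero_iff hm').1 h] with η hη
  refine Finset.disjoint_left.2 fun x hx hxs => ?_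
  have := Finset.sum_eq_zero_iff.1 hη x hx
  simp [hxs] at this

theorem ae_disjoint_prod (hd : 1 ≤ d) :
    ∀ᵐ η ∂(lebesguePoisson d).prod (lebesguePoisson d), Disjoint η.1.pts η.2.pts := by
  rw [Measure.ae_prod_iff_ae_ae measurableSet_disjointPairs]
  refine Filter.Eventually.of_forall fun η => ?_
  filter_upwards [ae_disjoint_finset hd η.pts] with ξ hξ using hξ.symm

theorem measurableEmbedding_val :
    MeasurableEmbedding (Subtype.val : FinConf2 d → FinConf d × FinConf d) :=
  MeasurableEmbedding.subtype_coe measurableSet_disjointPairs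

/-- Discarding the null set of intersecting pairs loses no mass, so integrals over $\Gamma_0^2$ may
be computed on the full product. -/
theorem measurePreserving_val (hd : 1 ≤ d) :
    MeasurePreserving (Subtype.val : FinConf2 d → FinConf d × FinConf d) (lebesguePoisson2 d)
      ((lebesguePoisson d).prod (lebesguePoisson d)) := by
  refine ⟨measurable_subtype_coe, ?_⟩
  unfold lebesguePoisson2
  have := map_comap_subtype_coe measurableSet_disjointPairs
    ((lebesguePoisson d).prod (lebesguePoisson d))
  rw [Measure.restrict_eq_self_of_ae_mem (s := {η : FinConf d × FinConf d | Disjoint η.1.pts η.2.pts})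
    (ae_disjoint_prod hd)] at this
  exact this

/-! ### The Minlos lemma for one component -/

/-- A subset with a marked point is the same as a point together with a subset of the remaining
ones. This brings marked sums into the form the Mecke formula needs. -/
theorem sum_powerset_sum_mem {α E : Type*} [DecidableEq α] [AddCommMonoid E] (s : Finset α)
    (g : α → Finset α → E) :
    ∑ a ∈ s.powerset, ∑ x ∈ a, g x a =
      ∑ x ∈ s, ∑ a ∈ (s.erase x).powerset, g x (insert x a) := by
  rw [Finset.sum_sigma', Finset.sum_sigma']
  refine Finset.sum_bij' (fun p _ => ⟨p.2, p.1.erase p.2⟩) (fun p _ => ⟨insert p.1 p.2, p.1⟩)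
    ?_ ?_ ?_ ?_ ?_
  · rintro ⟨a, x⟩ h
    simp only [Finset.mem_sigma, Finset.mem_powerset] at h ⊢
    exact ⟨h.1 h.2, Finset.erase_subset_erase _ h.1⟩
  · rintro ⟨x, a⟩ h
    simp only [Finset.mem_sigma, Finset.mem_powerset] at h ⊢
    exact ⟨Finset.insert_subset h.1 (h.2.trans (Finset.erase_subset _ _)),
      Finset.mem_insert_self _ _⟩
  · rintro ⟨a, x⟩ h
    simp only [Finset.mem_sigma] at h
    simp [Finset.insert_erase h.2]
  · rintro ⟨x, a⟩ h
    simp only [Finset.mem_sigma, Finset.mem_powerset] at h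
    have hx : x ∉ a := fun hx => (Finset.mem_erase.1 (h.2 hx)).1 rfl
    simp [Finset.erase_insert hx]
  · rintro ⟨a, x⟩ h
    simp only [Finset.mem_sigma] at h
    simp [Finset.insert_erase h.2]

theorem measurable_sum_powerset_sdiff {E : Type*} [MeasurableSpace E] [AddCommMonoid E]
    [MeasurableAdd₂ E] {h : X × FinConf d × FinConf d → E} (hh : Measurable h)
    {g : X → FinConf d} (hg : Measurable g) :
    Measurable fun x => ∑ a ∈ (g x).pts.powerset, h (x, ⟨a⟩, ⟨(g x).pts \ a⟩) :=
  measurable_sum_powerset (h := fun q : X × FinConf d => h (q.1, q.2, ⟨(g q.1).pts \ q.2.pts⟩))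
    (hh.comp (measurable_fst.prodMk (measurable_snd.prodMk
      (measurable_sdiff (hg.comp measurable_fst) measurable_snd)))) hg

theorem measurable_sum_pts_erase {E : Type*} [MeasurableSpace E] [AddCommMonoid E]
    [MeasurableAdd₂ E] {h : X × Pt d × FinConf d → E} (hh : Measurable h)
    {g : X → FinConf d} (hg : Measurable g) :
    Measurable fun x => ∑ y ∈ (g x).pts, h (x, y, ⟨(g x).pts.erase y⟩) :=
  measurable_sum_pts (h := fun q : X × Pt d => h (q.1, q.2, ⟨(g q.1).pts.erase q.2⟩))
    (hh.comp (measurable_fst.prodMk (measurable_snd.prodMk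
      (measurable_erase measurable_snd (hg.comp measurable_fst))))) hg

theorem lintegral_card_zero (hd : 1 ≤ d) {F : FinConf d → ℝ≥0∞} (hF : Measurable F)
    (h0 : ∀ ξ, ξ.pts.card ≠ 0 → F ξ = 0) : ∫⁻ ξ, F ξ ∂lebesguePoisson d = F ⟨∅⟩ := by
  rw [lintegral_lebesguePoisson hd hF, tsum_eq_single 0]
  · have : ∀ x : Fin 0 → Pt d, F (imageConf 0 x) = F ⟨∅⟩ := fun x => by simp [imageConf]
    simp only [this, lintegral_const, Nat.factorial_zero, Nat.cast_one, inv_one, one_mul]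
    rw [Measure.volume_pi_eq_dirac (0 : Fin 0 → Pt d)]
    simp
  · intro n hn
    have : ∀ x : Fin n → Pt d, F (imageConf n x) = 0 := by
      intro x
      apply h0
      have : NeZero n := ⟨hn⟩
      simpa [imageConf] using (Finset.univ_nonempty (α := Fin n)).ne_empty
    simp [this]

/-- Induction on the size of the selected part `a`. Multiplying by `n + 1` marks a point of `a`; the
Mecke formula extracts it and leaves a part of size `n`, to which the induction hypothesis applies.
On the other side the same formula, read backwards, reinserts the point. -/
theorem lintegral_minlos_card (hd : 1 ≤ d) (n : ℕ) : ∀ {f : FinConf d × FinConf d → ℝ≥0∞},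
    Measurable f → (∀ ξ ζ, ξ.pts.card ≠ n → f (ξ, ζ) = 0) →
    ∫⁻ η, ∑ a ∈ η.pts.powerset, f (⟨a⟩, ⟨η.pts \ a⟩) ∂lebesguePoisson d =
      ∫⁻ ζ, ∫⁻ ξ, f (ξ, ζ) ∂lebesguePoisson d ∂lebesguePoisson d := by
  induction n with
  | zero =>
    intro f hf h0
    refine lintegral_congr fun η => ?_
    rw [lintegral_card_zero hd (F := fun ξ => f (ξ, η)) (hf.comp measurable_prodMk_right)
      fun ξ => h0 ξ η, Finset.sum_eq_single ∅]
    · simp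
    · intro a _ ha
      exact h0 _ _ (by simpa using ha)
    · simp
  | succ n ih =>
    intro f hf h0
    have hc : ((n + 1 : ℕ) : ℝ≥0∞) ≠ 0 := by simp
    rw [← ENNReal.mul_right_inj hc (ENNReal.natCast_ne_top _)]
    -- The cut-off at `n` points makes `F`, for each fixed extracted point, satisfy the vanishing
    -- condition of the induction hypothesis.
    let F : (Pt d × FinConf d) × FinConf d → ℝ≥0∞ := fun q =>
      if q.1.2.pts.card = n then f (⟨insert q.1.1 q.1.2.pts⟩, q.2) else 0
    have hF : Measurable F := by
      refine Measurable.ite ?_ (hf.comp (Measurable.prodMk (measurable_insert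
        (measurable_fst.comp measurable_fst) (measurable_snd.comp measurable_fst))
          measurable_snd)) measurable_const
      exact (measurable_card.comp (measurable_snd.comp measurable_fst)) (measurableSet_singleton n)
    have hmP : Measurable fun η : FinConf d => ∑ a ∈ η.pts.powerset, f (⟨a⟩, ⟨η.pts \ a⟩) :=
      measurable_sum_powerset_sdiff (h := fun q : FinConf d × FinConf d × FinConf d => f q.2)
        (hf.comp measurable_snd) measurable_id
    have hmH : Measurable fun p : Pt d × FinConf d =>
        ∑ a ∈ p.2.pts.powerset, F ((p.1, ⟨a⟩), ⟨p.2.pts \ a⟩) :=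
      measurable_sum_powerset_sdiff
        (h := fun q : (Pt d × FinConf d) × FinConf d × FinConf d => F ((q.1.1, q.2.1), q.2.2))
        (hF.comp (by fun_prop)) measurable_snd
    have hl : ∀ η : FinConf d, ((n + 1 : ℕ) : ℝ≥0∞) *
        ∑ a ∈ η.pts.powerset, f (⟨a⟩, ⟨η.pts \ a⟩) =
        ∑ x ∈ η.pts, ∑ a ∈ (η.pts.erase x).powerset, F ((x, ⟨a⟩), ⟨η.pts.erase x \ a⟩) := by
      intro η
      have := sum_powerset_sum_mem η.pts fun (_ : Pt d) a => f (⟨a⟩, ⟨η.pts \ a⟩)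
      rw [Finset.mul_sum]
      refine Eq.trans (Finset.sum_congr rfl fun a _ => ?_) (this.trans ?_)
      · rw [Finset.sum_const, nsmul_eq_mul]
        by_cases ha : a.card = n + 1
        · rw [ha]
        · rw [h0 _ _ ha, mul_zero, mul_zero]
      · refine Finset.sum_congr rfl fun x _ => Finset.sum_congr rfl fun a ha => ?_
        have hx : x ∉ a := fun hx => (Finset.mem_erase.1 (Finset.mem_powerset.1 ha hx)).1 rfl
        have hs : η.pts \ insert x a = η.pts.erase x \ a := by
          ext y; simp only [Finset.mem_sdiff, Finset.mem_insert, Finset.mem_erase]; tauto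
        simp only [F, hs]
        split_ifs with hn
        · rfl
        · exact h0 _ _ (by simpa [Finset.card_insert_of_notMem hx] using hn)
    have hr : ∀ ξ ζ : FinConf d, ((n + 1 : ℕ) : ℝ≥0∞) * f (ξ, ζ) =
        ∑ x ∈ ξ.pts, F ((x, ⟨ξ.pts.erase x⟩), ζ) := by
      intro ξ ζ
      by_cases hξ : ξ.pts.card = n + 1
      · rw [← hξ, ← nsmul_eq_mul, ← Finset.sum_const]
        refine Finset.sum_congr rfl fun x hx => ?_
        simp [F, Finset.card_erase_of_mem hx, hξ, Finset.insert_erase hx]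
      · rw [h0 _ _ hξ, mul_zero]
        refine (Finset.sum_eq_zero fun x hx => ?_).symm
        have : (ξ.pts.erase x).card ≠ n := fun h => hξ (by rw [← h, Finset.card_erase_add_one hx])
        simp [F, this]
    rw [← lintegral_const_mul _ hmP, ← lintegral_const_mul _ hf.lintegral_prod_left']
    simp only [hl]
    rw [lintegral_mecke hd hmH]
    have hF' : ∀ x : Pt d, Measurable fun p : FinConf d × FinConf d => F ((x, p.1), p.2) :=
      fun x => hF.comp (by fun_prop)
    calc ∫⁻ x, ∫⁻ η, ∑ a ∈ η.pts.powerset, F ((x, ⟨a⟩), ⟨η.pts \ a⟩) ∂lebesguePoisson d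
        = ∫⁻ x, ∫⁻ ζ, ∫⁻ ξ, F ((x, ξ), ζ) ∂lebesguePoisson d ∂lebesguePoisson d :=
          lintegral_congr fun x => ih (f := fun p => F ((x, p.1), p.2)) (hF' x)
            fun ξ ζ h => if_neg h
      _ = ∫⁻ ζ, ∫⁻ x, ∫⁻ ξ, F ((x, ξ), ζ) ∂lebesguePoisson d ∂volume ∂lebesguePoisson d := by
          refine lintegral_lintegral_swap (Measurable.aemeasurable ?_)
          exact Measurable.lintegral_prod_right'
            (f := fun q : (Pt d × FinConf d) × FinConf d => F ((q.1.1, q.2), q.1.2))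
            (hF.comp (by fun_prop))
      _ = _ := by
          refine lintegral_congr fun ζ => ?_
          rw [← lintegral_const_mul _ (show Measurable fun ξ => f (ξ, ζ) from
            hf.comp measurable_prodMk_right)]
          simp only [hr]
          exact (lintegral_mecke hd (f := fun p => F (p, ζ)) (hF.comp measurable_prodMk_right)).symm

/-- The Minlos lemma. -/
theorem lintegral_minlos (hd : 1 ≤ d) {f : FinConf d × FinConf d → ℝ≥0∞} (hf : Measurable f) :
    ∫⁻ η, ∑ a ∈ η.pts.powerset, f (⟨a⟩, ⟨η.pts \ a⟩) ∂lebesguePoisson d =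
      ∫⁻ p, f p ∂(lebesguePoisson d).prod (lebesguePoisson d) := by
  let F : ℕ → FinConf d × FinConf d → ℝ≥0∞ := fun n p => if p.1.pts.card = n then f p else 0
  have hF : ∀ n, Measurable (F n) := fun n => Measurable.ite
    ((measurable_card.comp measurable_fst) (measurableSet_singleton n)) hf measurable_const
  have hsum : ∀ p, f p = ∑' n, F n p := fun p => by simp [F]
  have hm : ∀ n, Measurable fun η : FinConf d => ∑ a ∈ η.pts.powerset, F n (⟨a⟩, ⟨η.pts \ a⟩) :=
    fun n => measurable_sum_powerset_sdiff (h := fun q : FinConf d × FinConf d × FinConf d =>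
      F n q.2) ((hF n).comp measurable_snd) measurable_id
  simp only [hsum]
  rw [lintegral_tsum fun n => (hF n).aemeasurable]
  have : ∀ η : FinConf d, ∑ a ∈ η.pts.powerset, ∑' n, F n (⟨a⟩, ⟨η.pts \ a⟩) =
      ∑' n, ∑ a ∈ η.pts.powerset, F n (⟨a⟩, ⟨η.pts \ a⟩) := fun η =>
    (Summable.tsum_finsetSum fun _ _ => ENNReal.summable).symm
  simp only [this]
  rw [lintegral_tsum fun n => (hm n).aemeasurable]
  congr 1
  funext n
  rw [lintegral_minlos_card hd n (hF n) fun ξ ζ h => if_neg h,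
    lintegral_prod_symm _ (hF n).aemeasurable]

/-- The product `λ ⊗ λ` on `Γ₀ × Γ₀`. -/
abbrev poissonProd (d : ℕ) : Measure (FinConf d × FinConf d) :=
  (lebesguePoisson d).prod (lebesguePoisson d)

/-! ### Minlos and Mecke formulas for two components -/

theorem measurable_minlos_inner {E : Type*} [MeasurableSpace E] [AddCommMonoid E]
    [MeasurableAdd₂ E] {f : (FinConf d × FinConf d) × (FinConf d × FinConf d) → E}
    (hf : Measurable f) : Measurable fun q : (FinConf d × FinConf d) × FinConf d =>
      ∑ b ∈ q.2.pts.powerset, f ((q.1.1, ⟨b⟩), (q.1.2, ⟨q.2.pts \ b⟩)) :=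
  measurable_sum_powerset_sdiff (h := fun q : ((FinConf d × FinConf d) × FinConf d) ×
    FinConf d × FinConf d => f ((q.1.1.1, q.2.1), (q.1.1.2, q.2.2))) (hf.comp (by fun_prop))
    measurable_snd

theorem measurable_minlos_two {E : Type*} [MeasurableSpace E] [AddCommMonoid E]
    [MeasurableAdd₂ E] {f : (FinConf d × FinConf d) × (FinConf d × FinConf d) → E}
    (hf : Measurable f) : Measurable fun η : FinConf d × FinConf d => ∑ a ∈ η.1.pts.powerset,
      ∑ b ∈ η.2.pts.powerset, f ((⟨a⟩, ⟨b⟩), (⟨η.1.pts \ a⟩, ⟨η.2.pts \ b⟩)) :=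
  measurable_sum_powerset_sdiff (h := fun q : (FinConf d × FinConf d) × FinConf d × FinConf d =>
    ∑ b ∈ q.1.2.pts.powerset, f ((q.2.1, ⟨b⟩), (q.2.2, ⟨q.1.2.pts \ b⟩)))
    ((measurable_minlos_inner hf).comp
      (f := fun q : (FinConf d × FinConf d) × FinConf d × FinConf d => (q.2, q.1.2))
      (by fun_prop)) measurable_fst

theorem measurable_mecke_prod {E : Type*} [MeasurableSpace E] [AddCommMonoid E]
    [MeasurableAdd₂ E] {Z : Type*} [MeasurableSpace Z] {f : Pt d × FinConf d × Z → E}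
    (hf : Measurable f) : Measurable fun η : FinConf d × Z =>
      ∑ x ∈ η.1.pts, f (x, ⟨η.1.pts.erase x⟩, η.2) :=
  measurable_sum_pts_erase (h := fun q : (FinConf d × Z) × Pt d × FinConf d =>
    f (q.2.1, q.2.2, q.1.2)) (hf.comp (by fun_prop)) measurable_fst

theorem measurable_mecke_two {E : Type*} [MeasurableSpace E] [AddCommMonoid E]
    [MeasurableAdd₂ E] {f : (Pt d × FinConf d × FinConf d) × (FinConf d × FinConf d) → E}
    (hf : Measurable f) : Measurable fun p : (FinConf d × FinConf d) × (FinConf d × FinConf d) =>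
      ∑ x ∈ p.1.1.pts, f ((x, ⟨p.1.1.pts.erase x⟩, p.1.2), p.2) :=
  measurable_sum_pts_erase (h := fun q : ((FinConf d × FinConf d) × (FinConf d × FinConf d)) ×
    Pt d × FinConf d => f ((q.2.1, q.2.2, q.1.1.2), q.1.2)) (hf.comp (by fun_prop))
    (measurable_fst.comp measurable_fst)

/-- The one-component formula is applied in the `-` variable, with the `+` variable and its subset
fixed, and then in the `+` variable; Tonelli puts the four integrations in order. -/
theorem lintegral_minlos_two (hd : 1 ≤ d)
    {f : (FinConf d × FinConf d) × (FinConf d × FinConf d) → ℝ≥0∞} (hf : Measurable f) :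
    ∫⁻ η, ∑ a ∈ η.1.pts.powerset, ∑ b ∈ η.2.pts.powerset,
      f ((⟨a⟩, ⟨b⟩), (⟨η.1.pts \ a⟩, ⟨η.2.pts \ b⟩)) ∂poissonProd d =
      ∫⁻ p, f p ∂(poissonProd d).prod (poissonProd d) := by
  have hin := measurable_minlos_inner hf
  have hm := measurable_minlos_two hf
  have hg : Measurable fun p : FinConf d × FinConf d =>
      ∫⁻ q, f ((p.1, q.1), (p.2, q.2)) ∂poissonProd d :=
    Measurable.lintegral_prod_right' (f := fun r : (FinConf d × FinConf d) × FinConf d × FinConf d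
      => f ((r.1.1, r.2.1), (r.1.2, r.2.2))) (hf.comp (by fun_prop))
  rw [lintegral_prod _ hm.aemeasurable]
  calc _ = ∫⁻ ηp, ∑ a ∈ ηp.pts.powerset,
        ∫⁻ q, f ((⟨a⟩, q.1), (⟨ηp.pts \ a⟩, q.2)) ∂poissonProd d ∂lebesguePoisson d := by
        refine lintegral_congr fun ηp => ?_
        have hina : ∀ a : Finset (Pt d), Measurable fun q : FinConf d =>
            ∑ b ∈ q.pts.powerset, f ((⟨a⟩, ⟨b⟩), (⟨ηp.pts \ a⟩, ⟨q.pts \ b⟩)) := fun a =>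
          hin.comp (f := fun q : FinConf d =>
            (((⟨a⟩, ⟨ηp.pts \ a⟩), q) : (FinConf d × FinConf d) × FinConf d)) (by fun_prop)
        dsimp only
        rw [lintegral_finsetSum _ fun a _ => hina a]
        refine Finset.sum_congr rfl fun a _ => ?_
        exact lintegral_minlos hd (f := fun q => f ((⟨a⟩, q.1), (⟨ηp.pts \ a⟩, q.2)))
          (hf.comp (by fun_prop))
    _ = _ := by
        rw [lintegral_minlos hd hg, lintegral_prod _ hg.aemeasurable,
          lintegral_prod _ hf.aemeasurable,
          lintegral_prod _ hf.lintegral_prod_right'.aemeasurable]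
        refine lintegral_congr fun p₁ => ?_
        have h4 : Measurable fun r : FinConf d × FinConf d =>
            ∫⁻ q₂, f ((p₁, r.2), (r.1, q₂)) ∂lebesguePoisson d :=
          Measurable.lintegral_prod_right' (f := fun r : (FinConf d × FinConf d) × FinConf d =>
            f ((p₁, r.1.2), (r.1.1, r.2))) (hf.comp (by fun_prop))
        calc _ = ∫⁻ p₂, ∫⁻ q₁, ∫⁻ q₂, f ((p₁, q₁), (p₂, q₂)) ∂lebesguePoisson d
              ∂lebesguePoisson d ∂lebesguePoisson d := lintegral_congr fun p₂ =>
              lintegral_prod (fun q => f ((p₁, q.1), (p₂, q.2)))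
                (hf.comp (by fun_prop)).aemeasurable
          _ = ∫⁻ q₁, ∫⁻ p₂, ∫⁻ q₂, f ((p₁, q₁), (p₂, q₂)) ∂lebesguePoisson d
              ∂lebesguePoisson d ∂lebesguePoisson d := lintegral_lintegral_swap h4.aemeasurable
          _ = _ := lintegral_congr fun q₁ => (lintegral_prod (fun q => f ((p₁, q₁), q))
                (hf.comp (by fun_prop)).aemeasurable).symm

/-- The second factor is a spectator: Tonelli moves it outside, and the Mecke formula acts for each
fixed `z`. -/
theorem lintegral_mecke_prod (hd : 1 ≤ d) {Z : Type*} [MeasurableSpace Z] (ρ : Measure Z)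
    [SFinite ρ] {f : Pt d × FinConf d × Z → ℝ≥0∞} (hf : Measurable f) :
    ∫⁻ η, ∑ x ∈ η.1.pts, f (x, ⟨η.1.pts.erase x⟩, η.2) ∂(lebesguePoisson d).prod ρ =
      ∫⁻ p, f p ∂(volume : Measure (Pt d)).prod ((lebesguePoisson d).prod ρ) := by
  have hm := measurable_mecke_prod hf
  rw [lintegral_prod_symm _ hm.aemeasurable, lintegral_prod _ hf.aemeasurable]
  calc _ = ∫⁻ z, ∫⁻ x, ∫⁻ η, f (x, η, z) ∂lebesguePoisson d ∂volume ∂ρ :=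
        lintegral_congr fun z => lintegral_mecke hd (f := fun p => f (p.1, p.2, z))
          (hf.comp (by fun_prop))
    _ = ∫⁻ x, ∫⁻ z, ∫⁻ η, f (x, η, z) ∂lebesguePoisson d ∂ρ := by
        refine lintegral_lintegral_swap ?_
        exact (Measurable.lintegral_prod_right' (f := fun q : (Z × Pt d) × FinConf d =>
          f (q.1.2, q.2, q.1.1)) (hf.comp (by fun_prop))).aemeasurable
    _ = _ := lintegral_congr fun x =>
        (lintegral_prod_symm _ (hf.comp measurable_prodMk_left).aemeasurable).symm

theorem lintegral_mecke_two (hd : 1 ≤ d) {f : (Pt d × FinConf d × FinConf d) ×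
      (FinConf d × FinConf d) → ℝ≥0∞} (hf : Measurable f) :
    ∫⁻ p, ∑ x ∈ p.1.1.pts, f ((x, ⟨p.1.1.pts.erase x⟩, p.1.2), p.2)
      ∂(poissonProd d).prod (poissonProd d) =
      ∫⁻ p, f p ∂((volume : Measure (Pt d)).prod (poissonProd d)).prod (poissonProd d) := by
  have hm := measurable_mecke_two hf
  rw [lintegral_prod_symm _ hm.aemeasurable, lintegral_prod_symm _ hf.aemeasurable]
  exact lintegral_congr fun ζ => lintegral_mecke_prod hd (lebesguePoisson d)
    (f := fun p => f (p, ζ)) (hf.comp (by fun_prop))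

/-- If a positive summation operator transports lower integrals, it transports integrals. -/
theorem integral_sum_of_lintegral_sum {Y ι : Type*} [MeasurableSpace Y] {μ : Measure X}
    {ν : Measure Y} (s : X → Finset ι) (φ : X → ι → Y)
    (hm : ∀ f : Y → ℝ≥0∞, Measurable f → Measurable fun x => ∑ i ∈ s x, f (φ x i))
    (h : ∀ f : Y → ℝ≥0∞, Measurable f → ∫⁻ x, ∑ i ∈ s x, f (φ x i) ∂μ = ∫⁻ y, f y ∂ν)
    {f : Y → ℝ} (hf : Measurable f) (hfi : Integrable f ν) :
    Integrable (fun x => ∑ i ∈ s x, f (φ x i)) μ ∧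
      ∫ x, ∑ i ∈ s x, f (φ x i) ∂μ = ∫ y, f y ∂ν := by
  have hp : Measurable fun y => ENNReal.ofReal (f y) := hf.ennreal_ofReal
  have hn : Measurable fun y => ENNReal.ofReal (-f y) := hf.neg.ennreal_ofReal
  have hpf : ∫⁻ y, ENNReal.ofReal (f y) ∂ν ≠ ⊤ := hfi.lintegral_lt_top.ne
  have hnf : ∫⁻ y, ENNReal.ofReal (-f y) ∂ν ≠ ⊤ := hfi.neg.lintegral_lt_top.ne
  -- Positive and negative parts are transported separately; the sums are finite, so passing to
  -- `toReal` commutes with them.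
  have heq : (fun x => ∑ i ∈ s x, f (φ x i)) = fun x =>
      (∑ i ∈ s x, ENNReal.ofReal (f (φ x i))).toReal -
        (∑ i ∈ s x, ENNReal.ofReal (-f (φ x i))).toReal := by
    funext x
    rw [ENNReal.toReal_sum (by simp), ENNReal.toReal_sum (by simp), ← Finset.sum_sub_distrib]
    refine Finset.sum_congr rfl fun i _ => ?_
    rw [ENNReal.toReal_ofReal', ENNReal.toReal_ofReal']
    exact (max_zero_sub_max_neg_zero_eq_self _).symm
  have hip := integrable_toReal_of_lintegral_ne_top (hm _ hp).aemeasurable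
    ((h _ hp).trans_ne hpf)
  have hin := integrable_toReal_of_lintegral_ne_top (hm _ hn).aemeasurable
    ((h _ hn).trans_ne hnf)
  rw [heq]
  refine ⟨hip.sub hin, ?_⟩
  rw [integral_sub hip hin, integral_toReal (hm _ hp).aemeasurable
    (Filter.Eventually.of_forall fun x => by simp),
    integral_toReal (hm _ hn).aemeasurable (Filter.Eventually.of_forall fun x => by simp),
    h _ hp, h _ hn, integral_eq_lintegral_pos_part_sub_lintegral_neg_part hfi]

/-! ## Möbius inversion on finite sets -/

section Moebius

variable {α β : Type*} [DecidableEq α] [DecidableEq β]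

/-- This is $K^{-1}K=\mathrm{id}$ for one component. Adjoining `x` to `s`, the subsets with and
without `x` have opposite signs, so only the terms `f (insert x b)` survive. -/
theorem moebius_sum (s : Finset α) : ∀ f : Finset α → ℝ,
    ∑ a ∈ s.powerset, (-1 : ℝ) ^ (s \ a).card * ∑ b ∈ a.powerset, f b = f s := by
  induction s using Finset.induction_on with
  | empty => simp
  | insert x s hx ih =>
    intro f
    rw [Finset.sum_powerset_insert hx, ← ih fun a => f (insert x a), ← Finset.sum_add_distrib]
    refine Finset.sum_congr rfl fun a ha => ?_
    have hxa : x ∉ a := fun h => hx (Finset.mem_powerset.1 ha h)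
    rw [Finset.sum_powerset_insert hxa, Finset.insert_sdiff_of_notMem _ hxa,
      Finset.card_insert_of_notMem (by simp [hx]), Finset.insert_sdiff_insert,
      Finset.sdiff_insert_of_notMem hx, pow_succ]
    ring

/-- The opposite composition, $KK^{-1}=\mathrm{id}$, by the same cancellation. -/
theorem sum_moebius (s : Finset α) : ∀ f : Finset α → ℝ,
    ∑ a ∈ s.powerset, ∑ b ∈ a.powerset, (-1 : ℝ) ^ (a \ b).card * f b = f s := by
  induction s using Finset.induction_on with
  | empty => simp
  | insert x s hx ih =>
    intro f
    rw [Finset.sum_powerset_insert hx, ← ih fun a => f (insert x a), ← Finset.sum_add_distrib]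
    refine Finset.sum_congr rfl fun a ha => ?_
    have hxa : x ∉ a := fun h => hx (Finset.mem_powerset.1 ha h)
    rw [Finset.sum_powerset_insert hxa, ← Finset.sum_add_distrib, ← Finset.sum_add_distrib]
    refine Finset.sum_congr rfl fun b hb => ?_
    have hxb : x ∉ b := fun h => hxa (Finset.mem_powerset.1 hb h)
    rw [Finset.insert_sdiff_of_notMem _ hxb, Finset.card_insert_of_notMem (by simp [hxa]),
      Finset.insert_sdiff_insert, Finset.sdiff_insert_of_notMem hxa, pow_succ]
    ring

theorem moebius_sum_two (s : Finset α) (t : Finset β) (f : Finset α → Finset β → ℝ) :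
    ∑ a ∈ s.powerset, ∑ b ∈ t.powerset, (-1 : ℝ) ^ ((s \ a).card + (t \ b).card) *
      ∑ a' ∈ a.powerset, ∑ b' ∈ b.powerset, f a' b' = f s t := by
  rw [← moebius_sum s fun a => f a t]
  refine Finset.sum_congr rfl fun a _ => ?_
  simp only [← moebius_sum t (f _)]
  rw [Finset.sum_comm, Finset.mul_sum]
  refine Finset.sum_congr rfl fun b _ => ?_
  rw [Finset.sum_comm, pow_add, mul_assoc]
  simp only [← Finset.mul_sum]
  rw [Finset.sum_comm]

theorem sum_moebius_two (s : Finset α) (t : Finset β) (f : Finset α → Finset β → ℝ) :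
    ∑ a ∈ s.powerset, ∑ b ∈ t.powerset, ∑ a' ∈ a.powerset, ∑ b' ∈ b.powerset,
      (-1 : ℝ) ^ ((a \ a').card + (b \ b').card) * f a' b' = f s t := by
  rw [← sum_moebius s fun a => f a t]
  refine Finset.sum_congr rfl fun a _ => ?_
  rw [Finset.sum_comm]
  refine Finset.sum_congr rfl fun a' _ => ?_
  rw [← sum_moebius t (f a'), Finset.mul_sum]
  refine Finset.sum_congr rfl fun b _ => ?_
  rw [Finset.mul_sum]
  refine Finset.sum_congr rfl fun b' _ => ?_
  rw [pow_add, mul_assoc]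

/-- A pair of disjoint subsets is encoded by its union and its first member. This exhibits the
expansion of $L_+KG$ as a $K$-transform. -/
theorem sum_powerset_powerset_sdiff {E : Type*} [AddCommMonoid E] (s : Finset α)
    (h : Finset α → Finset α → E) :
    ∑ a ∈ s.powerset, ∑ c ∈ (s \ a).powerset, h a c =
      ∑ t ∈ s.powerset, ∑ a ∈ t.powerset, h a (t \ a) := by
  rw [Finset.sum_sigma', Finset.sum_sigma']
  refine Finset.sum_bij' (fun p _ => ⟨p.1 ∪ p.2, p.1⟩) (fun p _ => ⟨p.2, p.1 \ p.2⟩)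
    ?_ ?_ ?_ ?_ ?_
  · rintro ⟨a, c⟩ hp
    simp only [Finset.mem_sigma, Finset.mem_powerset] at hp ⊢
    exact ⟨Finset.union_subset hp.1 (hp.2.trans Finset.sdiff_subset), Finset.subset_union_left⟩
  · rintro ⟨t, a⟩ hp
    simp only [Finset.mem_sigma, Finset.mem_powerset] at hp ⊢
    exact ⟨hp.2.trans hp.1, Finset.sdiff_subset_sdiff hp.1 le_rfl⟩
  · rintro ⟨a, c⟩ hp
    simp only [Finset.mem_sigma, Finset.mem_powerset] at hp
    have hd : Disjoint c a := Finset.disjoint_of_subset_left hp.2 Finset.sdiff_disjoint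
    simp [Finset.union_sdiff_cancel_left hd.symm]
  · rintro ⟨t, a⟩ hp
    simp only [Finset.mem_sigma, Finset.mem_powerset] at hp
    simp [Finset.union_sdiff_of_subset hp.2]
  · rintro ⟨a, c⟩ hp
    simp only [Finset.mem_sigma, Finset.mem_powerset] at hp
    have hd : Disjoint c a := Finset.disjoint_of_subset_left hp.2 Finset.sdiff_disjoint
    simp [Finset.union_sdiff_cancel_left hd.symm]

theorem sum_powerset_powerset_sdiff_two {E : Type*} [AddCommMonoid E] (s : Finset α) (t : Finset β)
    (h : Finset α → Finset β → Finset α → Finset β → E) :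
    ∑ a ∈ s.powerset, ∑ b ∈ t.powerset, ∑ c ∈ (s \ a).powerset, ∑ e ∈ (t \ b).powerset, h a b c e =
      ∑ s' ∈ s.powerset, ∑ t' ∈ t.powerset, ∑ a ∈ s'.powerset, ∑ b ∈ t'.powerset,
        h a b (s' \ a) (t' \ b) := by
  calc _ = ∑ a ∈ s.powerset, ∑ c ∈ (s \ a).powerset, ∑ t' ∈ t.powerset, ∑ b ∈ t'.powerset,
        h a b c (t' \ b) := by
        refine Finset.sum_congr rfl fun a _ => ?_
        rw [Finset.sum_comm]
        exact Finset.sum_congr rfl fun c _ => sum_powerset_powerset_sdiff t fun b e => h a b c e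
    _ = _ := by
        rw [sum_powerset_powerset_sdiff s fun a c => ∑ t' ∈ t.powerset, ∑ b ∈ t'.powerset,
          h a b c (t' \ b)]
        exact Finset.sum_congr rfl fun s' _ => Finset.sum_comm

end Moebius

/-! ## The pointwise form of `L̂` -/

theorem onPair_of_disjoint (G : FinConf2 d → ℝ) {a b : Finset (Pt d)} (h : Disjoint a b) :
    onPair G a b = G ⟨(⟨a⟩, ⟨b⟩), h⟩ := dif_pos h

theorem onPair_of_not_disjoint (G : FinConf2 d → ℝ) {a b : Finset (Pt d)} (h : ¬ Disjoint a b) :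
    onPair G a b = 0 := dif_neg h

theorem onPair_plus_minus (G : FinConf2 d → ℝ) (η : FinConf2 d) :
    onPair G η.plus η.minus = G η := onPair_of_disjoint G η.2

theorem rateK_of_disjoint (r : Pt d → FinConf2 d → ℝ) (x : Pt d) (ξp ξm : Finset (Pt d))
    {ηp ηm : Finset (Pt d)} (h : Disjoint ηp ηm) :
    rateK r x ξp ξm ηp ηm = ∑ a ∈ ηp.powerset, ∑ b ∈ ηm.powerset,
      (-1 : ℝ) ^ ((ηp \ a).card + (ηm \ b).card) * onPair (r x) (a ∪ ξp) (b ∪ ξm) := by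
  unfold rateK
  rw [onPair_of_disjoint _ h]
  unfold Kinv
  refine Finset.sum_congr rfl fun a ha => Finset.sum_congr rfl fun b hb => ?_
  rw [onPair_of_disjoint _ (Finset.disjoint_of_subset_left (Finset.mem_powerset.1 ha)
    (Finset.disjoint_of_subset_right (Finset.mem_powerset.1 hb) h))]

/-- Since $KK^{-1}=\mathrm{id}$, a rate is recovered from its Möbius coefficients around the base
pair `(ξp, ξm)`. No disjointness from the base pair is needed, as `onPair` vanishes on meeting sets.
-/
theorem onPair_eq_sum_rateK (r : Pt d → FinConf2 d → ℝ) (x : Pt d) (ξp ξm : Finset (Pt d))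
    {s t : Finset (Pt d)} (h : Disjoint s t) :
    onPair (r x) (s ∪ ξp) (t ∪ ξm) =
      ∑ c ∈ s.powerset, ∑ e ∈ t.powerset, rateK r x ξp ξm c e := by
  rw [← sum_moebius_two s t fun a b => onPair (r x) (a ∪ ξp) (b ∪ ξm)]
  refine Finset.sum_congr rfl fun a ha => Finset.sum_congr rfl fun b hb => ?_
  rw [rateK_of_disjoint _ _ _ _ (Finset.disjoint_of_subset_left (Finset.mem_powerset.1 ha)
    (Finset.disjoint_of_subset_right (Finset.mem_powerset.1 hb) h))]

/-- A uniform description of the bounds for a function in `B_bs(Γ₀²)`. -/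
theorem IsBbs.exists_bound {G : FinConf2 d → ℝ} (hG : IsBbs G) :
    ∃ (C : ℝ) (N : ℕ) (Λ : Set (Pt d)), 0 ≤ C ∧ IsBoundedBorel Λ ∧
      (∀ a b, |onPair G a b| ≤ C) ∧ ∀ a b, onPair G a b ≠ 0 →
        Disjoint a b ∧ (a : Set (Pt d)) ⊆ Λ ∧ (b : Set (Pt d)) ⊆ Λ ∧ a.card ≤ N ∧ b.card ≤ N := by
  obtain ⟨C, hC⟩ := hG.bounded
  obtain ⟨Np, Nm, Λp, Λm, hΛp, hΛm, hs⟩ := hG.bounded_support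
  refine ⟨|C|, max Np Nm, Λp ∪ Λm, abs_nonneg _, ⟨hΛp.1.union hΛm.1, hΛp.2.union hΛm.2⟩, ?_, ?_⟩
  · intro a b
    by_cases h : Disjoint a b
    · rw [onPair_of_disjoint _ h]
      exact (hC _).trans (le_abs_self C)
    · rw [onPair_of_not_disjoint _ h]
      simp
  · intro a b hne
    by_cases h : Disjoint a b
    · rw [onPair_of_disjoint _ h] at hne
      have := not_not.1 fun hn => hne (hs _ hn)
      obtain ⟨⟨h1, h2⟩, h3, h4⟩ := this
      exact ⟨h, h1.trans Set.subset_union_left, h3.trans Set.subset_union_right,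
        h2.trans (le_max_left _ _), h4.trans (le_max_right _ _)⟩
    · exact absurd (onPair_of_not_disjoint G h) hne

theorem IsRate.locallyIntegrable_onPair {r : Pt d → FinConf2 d → ℝ} (hr : IsRate r)
    (a b : Finset (Pt d)) : LocallyIntegrable (fun x => onPair (r x) a b) := by
  by_cases h : Disjoint a b
  · simp only [onPair_of_disjoint _ h]
    exact hr.locallyIntegrable _
  · simp only [onPair_of_not_disjoint _ h]
    exact locallyIntegrable_zero

theorem IsRate.locallyIntegrable_rateK {r : Pt d → FinConf2 d → ℝ} (hr : IsRate r)
    (ξp ξm ηp ηm : Finset (Pt d)) : LocallyIntegrable (fun x => rateK r x ξp ξm ηp ηm) := by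
  by_cases h : Disjoint ηp ηm
  · simp only [rateK_of_disjoint _ _ _ _ h]
    refine locallyIntegrable_finsetSum _ fun a _ => locallyIntegrable_finsetSum _ fun b _ => ?_
    exact (hr.locallyIntegrable_onPair _ _).smul ((-1 : ℝ) ^ _)
  · simp only [rateK, onPair_of_not_disjoint _ h]
    exact locallyIntegrable_zero

/-- The support of `G` confines the inserted point to a bounded set, where `φ` is integrable. Local
integrability of the birth rates serves to make the birth integral termwise integrable. -/
theorem IsBbs.integrable_insert_mul {G : FinConf2 d → ℝ} (hG : IsBbs G) {φ : Pt d → ℝ}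
    (hφ : LocallyIntegrable φ) (a b : Finset (Pt d)) :
    Integrable fun x => onPair G (insert x a) b * φ x := by
  obtain ⟨C, N, Λ, -, hΛ, hC, hs⟩ := hG.exists_bound
  have hi : IntegrableOn φ Λ :=
    (hφ.integrableOn_isCompact hΛ.2.isCompact_closure).mono_set subset_closure
  have hm : Measurable fun x : Pt d => onPair G (insert x a) b :=
    measurable_onPair hG.measurable (g := fun x : Pt d => ⟨insert x a⟩) (g' := fun _ => ⟨b⟩)
      (measurable_insert (g := fun _ => ⟨a⟩) measurable_id measurable_const) measurable_const
  have h2 : IntegrableOn (fun x => onPair G (insert x a) b * φ x) Λ :=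
    Integrable.bdd_mul (c := C) hi hm.aestronglyMeasurable
      (Filter.Eventually.of_forall fun x => hC _ _)
  refine (integrableOn_iff_integrable_of_support_subset fun x hx => ?_).1 h2
  exact (hs _ _ (left_ne_zero_of_mul hx)).2.1 (by simp)

/-- The summand of `L̂₊ G`. -/
def lhatPlus (dp bp : Pt d → FinConf2 d → ℝ) (G : FinConf2 d → ℝ)
    (ξp ξm ζp ζm : Finset (Pt d)) : ℝ :=
  -(∑ x ∈ ξp, onPair G ξp ξm * rateK dp x (ξp.erase x) ξm ζp ζm) +
    ∫ x, onPair G (insert x ξp) ξm * rateK bp x ξp ξm ζp ζm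

theorem onPair_Ktrans (G : FinConf2 d → ℝ) {a b : Finset (Pt d)} (h : Disjoint a b) :
    onPair (Ktrans G) a b = ∑ a' ∈ a.powerset, ∑ b' ∈ b.powerset, onPair G a' b' :=
  onPair_of_disjoint _ h

/-- Removing `x` from `γ` deletes from $KG$ exactly the terms whose subset `a` contains `x`. For
each such `a` the rate is expanded around `(a.erase x, b)`. -/
theorem death_term (dp : Pt d → FinConf2 d → ℝ) (G : FinConf2 d → ℝ) (γ : FinConf2 d) :
    ∑ x ∈ γ.plus, onPair (dp x) (γ.plus.erase x) γ.minus *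
      (onPair (Ktrans G) (γ.plus.erase x) γ.minus - Ktrans G γ) =
    ∑ a ∈ γ.plus.powerset, ∑ b ∈ γ.minus.powerset, ∑ c ∈ (γ.plus \ a).powerset,
      ∑ e ∈ (γ.minus \ b).powerset,
        -∑ x ∈ a, onPair G a b * rateK dp x (a.erase x) b c e := by
  have h1 : ∀ x ∈ γ.plus, onPair (Ktrans G) (γ.plus.erase x) γ.minus - Ktrans G γ =
      -∑ a ∈ γ.plus.powerset, if x ∈ a then ∑ b ∈ γ.minus.powerset, onPair G a b else 0 := by
    intro x hx
    rw [onPair_Ktrans _ (Finset.disjoint_of_subset_left (Finset.erase_subset _ _) γ.2)]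
    unfold Ktrans
    conv_lhs => rw [← Finset.insert_erase hx]
    conv_rhs => rw [← Finset.insert_erase hx]
    have hx' : x ∉ γ.plus.erase x := Finset.notMem_erase _ _
    rw [Finset.sum_powerset_insert hx', Finset.sum_powerset_insert hx']
    have h0 : ∑ a ∈ (γ.plus.erase x).powerset,
        (if x ∈ a then ∑ b ∈ γ.minus.powerset, onPair G a b else 0) = 0 :=
      Finset.sum_eq_zero fun a ha => if_neg fun h => hx' (Finset.mem_powerset.1 ha h)
    rw [h0]
    simp
  have h2 : ∀ x ∈ γ.plus, onPair (dp x) (γ.plus.erase x) γ.minus *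
      (onPair (Ktrans G) (γ.plus.erase x) γ.minus - Ktrans G γ) =
      ∑ a ∈ γ.plus.powerset, if x ∈ a then -∑ b ∈ γ.minus.powerset, onPair G a b *
        onPair (dp x) (γ.plus.erase x) γ.minus else 0 := by
    intro x hx
    rw [h1 x hx, mul_neg, Finset.mul_sum, ← Finset.sum_neg_distrib]
    refine Finset.sum_congr rfl fun a _ => ?_
    split_ifs
    · rw [Finset.mul_sum]
      simp only [mul_comm]
    · simp
  rw [Finset.sum_congr rfl h2, Finset.sum_comm]
  refine Finset.sum_congr rfl fun a ha => ?_
  have ha' := Finset.mem_powerset.1 ha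
  rw [← Finset.sum_filter, Finset.filter_mem_eq_inter, Finset.inter_eq_right.2 ha',
    Finset.sum_neg_distrib, Finset.sum_comm, ← Finset.sum_neg_distrib]
  refine Finset.sum_congr rfl fun b hb => ?_
  have hb' := Finset.mem_powerset.1 hb
  simp only [Finset.sum_neg_distrib]
  congr 1
  have h3 : ∀ x ∈ a, onPair G a b * onPair (dp x) (γ.plus.erase x) γ.minus =
      ∑ c ∈ (γ.plus \ a).powerset, ∑ e ∈ (γ.minus \ b).powerset,
        onPair G a b * rateK dp x (a.erase x) b c e := by
    intro x hx
    -- The argument of the rate is split into its base `a.erase x` and the points outside `a`, so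
    -- that `onPair_eq_sum_rateK` applies.
    have e1 : γ.plus.erase x = (γ.plus \ a) ∪ a.erase x := by
      ext y
      simp only [Finset.mem_erase, Finset.mem_union, Finset.mem_sdiff]
      constructor
      · rintro ⟨h1, h2⟩
        by_cases hy : y ∈ a <;> simp [*]
      · rintro (⟨h1, h2⟩ | ⟨h1, h2⟩)
        · exact ⟨fun h => h2 (h ▸ hx), h1⟩
        · exact ⟨h1, ha' h2⟩
    rw [e1]
    conv_lhs => rw [← Finset.sdiff_union_of_subset hb']
    rw [onPair_eq_sum_rateK dp x (a.erase x) b (Finset.disjoint_of_subset_left Finset.sdiff_subset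
      (Finset.disjoint_of_subset_right Finset.sdiff_subset γ.2))]
    simp only [Finset.mul_sum]
  rw [Finset.sum_congr rfl h3, Finset.sum_comm]
  exact Finset.sum_congr rfl fun c _ => Finset.sum_comm

/-- For almost every `x` the point is new, and adding it contributes the terms `G (insert x a) b`.
The rate at `γ` is then expanded around `(a, b)`, and the finite sums leave the integral. -/
theorem birth_term (hd : 1 ≤ d) {bp : Pt d → FinConf2 d → ℝ} (hbp : IsRate bp)
    {G : FinConf2 d → ℝ} (hG : IsBbs G) (γ : FinConf2 d) :
    ∫ x, bp x γ * (onPair (Ktrans G) (insert x γ.plus) γ.minus - Ktrans G γ) =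
    ∑ a ∈ γ.plus.powerset, ∑ b ∈ γ.minus.powerset, ∑ c ∈ (γ.plus \ a).powerset,
      ∑ e ∈ (γ.minus \ b).powerset, ∫ x, onPair G (insert x a) b * rateK bp x a b c e := by
  have hne : Nonempty (Fin d) := ⟨⟨0, hd⟩⟩
  have hae : ∀ᵐ x : Pt d, x ∉ γ.plus ∪ γ.minus :=
    measure_eq_zero_iff_ae_notMem.1 ((γ.plus ∪ γ.minus).finite_toSet.measure_zero volume)
  have hi := fun a b c e => hG.integrable_insert_mul (hbp.locallyIntegrable_rateK a b c e) a b
  have h1 : ∀ᵐ x : Pt d, bp x γ * (onPair (Ktrans G) (insert x γ.plus) γ.minus - Ktrans G γ) =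
      ∑ a ∈ γ.plus.powerset, ∑ b ∈ γ.minus.powerset, ∑ c ∈ (γ.plus \ a).powerset,
        ∑ e ∈ (γ.minus \ b).powerset, onPair G (insert x a) b * rateK bp x a b c e := by
    filter_upwards [hae] with x hx
    rw [Finset.mem_union, not_or] at hx
    rw [onPair_Ktrans _ (Finset.disjoint_insert_left.2 ⟨hx.2, γ.2⟩),
      Finset.sum_powerset_insert hx.1, Ktrans, add_sub_cancel_left, Finset.mul_sum]
    refine Finset.sum_congr rfl fun a ha => ?_
    rw [Finset.mul_sum]
    refine Finset.sum_congr rfl fun b hb => ?_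
    have := onPair_eq_sum_rateK bp x a b (Finset.disjoint_of_subset_left
      (Finset.sdiff_subset (s := γ.plus) (t := a))
      (Finset.disjoint_of_subset_right (Finset.sdiff_subset (s := γ.minus) (t := b)) γ.2))
    rw [Finset.sdiff_union_of_subset (Finset.mem_powerset.1 ha),
      Finset.sdiff_union_of_subset (Finset.mem_powerset.1 hb), onPair_plus_minus] at this
    rw [this, mul_comm]
    simp only [Finset.mul_sum]
  rw [integral_congr_ae h1]
  have i1 := fun a b c (t : Finset (Finset (Pt d))) =>
    integrable_finsetSum t fun e _ => hi a b c e
  have i2 := fun a b (s : Finset (Finset (Pt d))) (t : Finset (Finset (Pt d))) =>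
    integrable_finsetSum s fun c _ => i1 a b c t
  rw [integral_finsetSum _ fun a _ => integrable_finsetSum _ fun b _ => i2 a b _ _]
  refine Finset.sum_congr rfl fun a _ => ?_
  rw [integral_finsetSum _ fun b _ => i2 a b _ _]
  refine Finset.sum_congr rfl fun b _ => ?_
  rw [integral_finsetSum _ fun c _ => i1 a b c _]
  refine Finset.sum_congr rfl fun c _ => ?_
  rw [integral_finsetSum _ fun e _ => hi a b c e]

/-- By `death_term` and `birth_term`, regrouped by the union of the two subsets, `genPlus` applied
to a $K$-transform is the $K$-transform of the right-hand side; `moebius_sum_two` removes the outer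
transform. -/
theorem Kinv_genPlus (hd : 1 ≤ d) (dp : Pt d → FinConf2 d → ℝ) {bp : Pt d → FinConf2 d → ℝ}
    (hbp : IsRate bp) {G : FinConf2 d → ℝ} (hG : IsBbs G) (η : FinConf2 d) :
    Kinv (genPlus dp bp (Ktrans G)) η = ∑ a ∈ η.plus.powerset, ∑ b ∈ η.minus.powerset,
      lhatPlus dp bp G a b (η.plus \ a) (η.minus \ b) := by
  unfold Kinv
  rw [← moebius_sum_two η.plus η.minus fun s t => ∑ a ∈ s.powerset, ∑ b ∈ t.powerset,
    lhatPlus dp bp G a b (s \ a) (t \ b)]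
  refine Finset.sum_congr rfl fun s hs => Finset.sum_congr rfl fun t ht => ?_
  have hst : Disjoint s t := Finset.disjoint_of_subset_left (Finset.mem_powerset.1 hs)
    (Finset.disjoint_of_subset_right (Finset.mem_powerset.1 ht) η.2)
  rw [onPair_of_disjoint _ hst, ← sum_powerset_powerset_sdiff_two]
  congr 1
  unfold genPlus
  rw [death_term, birth_term hd hbp hG]
  simp only [← Finset.sum_add_distrib]
  rfl

/-! ## Integrals of kernels depending on a point and two pairs of configurations -/

/-- Pairs of finite configurations, not necessarily disjoint. -/
abbrev ConfPair (d : ℕ) := FinConf d × FinConf d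

/-- The product of Lebesgue measure and of two copies of `λ ⊗ λ`. -/
abbrev kernelMeasure (d : ℕ) : Measure ((Pt d × ConfPair d) × ConfPair d) :=
  ((volume : Measure (Pt d)).prod (poissonProd d)).prod (poissonProd d)

/-- Minlos separates the subsets from their complements, and Mecke extracts the point marked in the
`+` subset. -/
theorem lintegral_kernel_erase (hd : 1 ≤ d) {f : (Pt d × ConfPair d) × ConfPair d → ℝ≥0∞}
    (hf : Measurable f) :
    ∫⁻ η : ConfPair d, ∑ a ∈ η.1.pts.powerset, ∑ b ∈ η.2.pts.powerset, ∑ x ∈ a,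
      f ((x, ⟨a.erase x⟩, ⟨b⟩), (⟨η.1.pts \ a⟩, ⟨η.2.pts \ b⟩)) ∂poissonProd d =
    ∫⁻ p, f p ∂kernelMeasure d :=
  (lintegral_minlos_two hd (measurable_mecke_two hf)).trans (lintegral_mecke_two hd hf)

theorem measurePreserving_kernel :
    MeasurePreserving (fun p : (ConfPair d × ConfPair d) × Pt d => ((p.2, p.1.1), p.1.2))
      (((poissonProd d).prod (poissonProd d)).prod volume) (kernelMeasure d) :=
  ((measurePreserving_prodAssoc (volume : Measure (Pt d)) (poissonProd d) (poissonProd d)).symm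
    MeasurableEquiv.prodAssoc).comp Measure.measurePreserving_swap

/-- Here the extra point is already integrated, so Minlos and Tonelli suffice. Deaths and births end
in the same measure. -/
theorem lintegral_kernel_birth (hd : 1 ≤ d) {f : (Pt d × ConfPair d) × ConfPair d → ℝ≥0∞}
    (hf : Measurable f) :
    ∫⁻ η : ConfPair d, ∑ a ∈ η.1.pts.powerset, ∑ b ∈ η.2.pts.powerset,
      ∫⁻ x, f ((x, ⟨a⟩, ⟨b⟩), (⟨η.1.pts \ a⟩, ⟨η.2.pts \ b⟩)) ∂volume ∂poissonProd d =
    ∫⁻ p, f p ∂kernelMeasure d := by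
  have hg : Measurable fun p : (ConfPair d × ConfPair d) × Pt d => f ((p.2, p.1.1), p.1.2) :=
    hf.comp (by fun_prop)
  refine (lintegral_minlos_two hd hg.lintegral_prod_right').trans ?_
  rw [← lintegral_prod _ hg.aemeasurable, measurePreserving_kernel.lintegral_comp hf]

theorem integral_minlos_two (hd : 1 ≤ d) {f : ConfPair d × ConfPair d → ℝ} (hf : Measurable f)
    (hfi : Integrable f ((poissonProd d).prod (poissonProd d))) :
    Integrable (fun η : ConfPair d => ∑ a ∈ η.1.pts.powerset, ∑ b ∈ η.2.pts.powerset,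
      f ((⟨a⟩, ⟨b⟩), (⟨η.1.pts \ a⟩, ⟨η.2.pts \ b⟩))) (poissonProd d) ∧
    ∫ η : ConfPair d, ∑ a ∈ η.1.pts.powerset, ∑ b ∈ η.2.pts.powerset,
      f ((⟨a⟩, ⟨b⟩), (⟨η.1.pts \ a⟩, ⟨η.2.pts \ b⟩)) ∂poissonProd d =
      ∫ p, f p ∂(poissonProd d).prod (poissonProd d) := by
  have := integral_sum_of_lintegral_sum (μ := poissonProd d)
    (ν := (poissonProd d).prod (poissonProd d))
    -- The double sum becomes one sum over a product index set, as the general transport lemma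
    -- requires.
    (fun η : ConfPair d => η.1.pts.powerset ×ˢ η.2.pts.powerset)
    (fun η i => (((⟨i.1⟩, ⟨i.2⟩), (⟨η.1.pts \ i.1⟩, ⟨η.2.pts \ i.2⟩)) : ConfPair d × ConfPair d))
    (fun g hg => by simpa only [Finset.sum_product] using measurable_minlos_two hg)
    (fun g hg => by simpa only [Finset.sum_product] using lintegral_minlos_two hd hg) hf hfi
  simpa only [Finset.sum_product] using this

theorem integral_kernel_erase (hd : 1 ≤ d) {f : (Pt d × ConfPair d) × ConfPair d → ℝ}
    (hf : Measurable f) (hfi : Integrable f (kernelMeasure d)) :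
    Integrable (fun η : ConfPair d => ∑ a ∈ η.1.pts.powerset, ∑ b ∈ η.2.pts.powerset, ∑ x ∈ a,
      f ((x, ⟨a.erase x⟩, ⟨b⟩), (⟨η.1.pts \ a⟩, ⟨η.2.pts \ b⟩))) (poissonProd d) ∧
    ∫ η : ConfPair d, ∑ a ∈ η.1.pts.powerset, ∑ b ∈ η.2.pts.powerset, ∑ x ∈ a,
      f ((x, ⟨a.erase x⟩, ⟨b⟩), (⟨η.1.pts \ a⟩, ⟨η.2.pts \ b⟩)) ∂poissonProd d =
    ∫ p, f p ∂kernelMeasure d := by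
  obtain ⟨h1, h2⟩ := integral_sum_of_lintegral_sum (μ := (poissonProd d).prod (poissonProd d))
    (ν := kernelMeasure d) (fun p : ConfPair d × ConfPair d => p.1.1.pts)
    (fun p x => ((x, ⟨p.1.1.pts.erase x⟩, p.1.2), p.2))
    (fun g hg => measurable_mecke_two hg) (fun g hg => lintegral_mecke_two hd hg) hf hfi
  obtain ⟨h3, h4⟩ := integral_minlos_two hd (measurable_mecke_two hf) h1
  exact ⟨h3, h4.trans h2⟩

theorem integral_kernel_birth (hd : 1 ≤ d) {f : (Pt d × ConfPair d) × ConfPair d → ℝ}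
    (hf : Measurable f) (hfi : Integrable f (kernelMeasure d)) :
    Integrable (fun η : ConfPair d => ∑ a ∈ η.1.pts.powerset, ∑ b ∈ η.2.pts.powerset,
      ∫ x, f ((x, ⟨a⟩, ⟨b⟩), (⟨η.1.pts \ a⟩, ⟨η.2.pts \ b⟩))) (poissonProd d) ∧
    ∫ η : ConfPair d, ∑ a ∈ η.1.pts.powerset, ∑ b ∈ η.2.pts.powerset,
      ∫ x, f ((x, ⟨a⟩, ⟨b⟩), (⟨η.1.pts \ a⟩, ⟨η.2.pts \ b⟩)) ∂volume ∂poissonProd d =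
    ∫ p, f p ∂kernelMeasure d := by
  have hg : Measurable fun p : (ConfPair d × ConfPair d) × Pt d => f ((p.2, p.1.1), p.1.2) :=
    hf.comp (by fun_prop)
  have hgi := measurePreserving_kernel.integrable_comp_of_integrable hfi
  obtain ⟨h3, h4⟩ := integral_minlos_two hd
    (hg.stronglyMeasurable.integral_prod_right' (ν := volume)).measurable hgi.integral_prod_left
  refine ⟨h3, h4.trans ?_⟩
  have h5 := integral_prod _ hgi
  refine h5.symm.trans ?_
  rw [← measurePreserving_kernel.map_eq,
    integral_map measurePreserving_kernel.measurable.aemeasurable hf.aestronglyMeasurable]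
  rfl

/-- The sum over the points of the first component of the integrals of a kernel. -/
def kernelSum (κ : (Pt d × ConfPair d) × ConfPair d → ℝ) (η : ConfPair d) : ℝ :=
  ∑ x ∈ η.1.pts, ∫ ζ, κ ((x, ⟨η.1.pts.erase x⟩, η.2), ζ) ∂poissonProd d

/-- The kernel weighted with a function on `Γ₀²`. -/
def weighted (G : FinConf2 d → ℝ) (κ : (Pt d × ConfPair d) × ConfPair d → ℝ)
    (p : (Pt d × ConfPair d) × ConfPair d) : ℝ :=
  onPair G (insert p.1.1 p.1.2.1.pts) p.1.2.2.pts * κ p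

theorem measurable_weighted {G : FinConf2 d → ℝ} (hG : Measurable G)
    {κ : (Pt d × ConfPair d) × ConfPair d → ℝ} (hκ : Measurable κ) :
    Measurable (weighted G κ) := by
  refine Measurable.mul ?_ hκ
  exact measurable_onPair hG (measurable_insert (f := fun p : (Pt d × ConfPair d) × ConfPair d =>
    p.1.1) (g := fun p => p.1.2.1) (by fun_prop) (by fun_prop)) (g' := fun p => p.1.2.2)
      (by fun_prop)

theorem measurable_kernelSum {κ : (Pt d × ConfPair d) × ConfPair d → ℝ} (hκ : Measurable κ) :
    Measurable (kernelSum κ) :=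
  measurable_mecke_prod (f := fun p : Pt d × ConfPair d => ∫ ζ, κ (p, ζ) ∂poissonProd d)
    (hκ.stronglyMeasurable.integral_prod_right' (ν := poissonProd d)).measurable

theorem weighted_erase (G : FinConf2 d → ℝ) (κ : (Pt d × ConfPair d) × ConfPair d → ℝ)
    {η : ConfPair d} {x : Pt d} (hx : x ∈ η.1.pts) (ζ : ConfPair d) :
    weighted G κ ((x, ⟨η.1.pts.erase x⟩, η.2), ζ) =
      onPair G η.1.pts η.2.pts * κ ((x, ⟨η.1.pts.erase x⟩, η.2), ζ) := by
  simp [weighted, Finset.insert_erase hx]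

/-- This is the dual side for deaths and births alike. Under Mecke the weight `G (insert x ξ)`
becomes `G η` with `x ∈ η`, which does not depend on `x` and leaves the sum. -/
theorem integral_mul_kernelSum (hd : 1 ≤ d) {κ : (Pt d × ConfPair d) × ConfPair d → ℝ}
    (hκ : Measurable κ) {G : FinConf2 d → ℝ} (hG : Measurable G)
    (hi : Integrable (weighted G κ) (kernelMeasure d)) :
    Integrable (fun η : ConfPair d => onPair G η.1.pts η.2.pts * kernelSum κ η) (poissonProd d) ∧
    ∫ η : ConfPair d, onPair G η.1.pts η.2.pts * kernelSum κ η ∂poissonProd d =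
      ∫ p, weighted G κ p ∂kernelMeasure d := by
  have hm := measurable_weighted hG hκ
  have h1 := integral_sum_of_lintegral_sum (μ := poissonProd d)
    (ν := (volume : Measure (Pt d)).prod (poissonProd d)) (fun η : ConfPair d => η.1.pts)
    (fun η x => (x, ⟨η.1.pts.erase x⟩, η.2)) (fun g hg => measurable_mecke_prod hg)
    (fun g hg => lintegral_mecke_prod hd _ hg)
    (hm.stronglyMeasurable.integral_prod_right' (ν := poissonProd d)).measurable
    hi.integral_prod_left
  rw [← integral_prod _ hi] at h1
  have h2 : ∀ η : ConfPair d, onPair G η.1.pts η.2.pts * kernelSum κ η = ∑ x ∈ η.1.pts,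
      ∫ ζ, weighted G κ ((x, ⟨η.1.pts.erase x⟩, η.2), ζ) ∂poissonProd d := by
    intro η
    rw [kernelSum, Finset.mul_sum]
    refine Finset.sum_congr rfl fun x hx => ?_
    simp only [weighted_erase G κ hx]
    rw [integral_const_mul]
  simp only [h2]
  exact h1

/-- The indicator function of the pairs of configurations with at most `N` points each that lie
in the ball of radius `N`. -/
def cutoff (d N : ℕ) (η : FinConf2 d) : ℝ :=
  if ((η.plus : Set (Pt d)) ⊆ Metric.ball 0 N ∧ η.plus.card ≤ N) ∧
    ((η.minus : Set (Pt d)) ⊆ Metric.ball 0 N ∧ η.minus.card ≤ N) then 1 else 0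

theorem isBbs_cutoff (d N : ℕ) : IsBbs (cutoff d N) := by
  have hp : Measurable fun η : FinConf2 d => η.1.1 := measurable_fst.comp measurable_subtype_coe
  have hm : Measurable fun η : FinConf2 d => η.1.2 := measurable_snd.comp measurable_subtype_coe
  refine ⟨?_, ⟨1, fun η => ?_⟩, N, N, Metric.ball 0 N, Metric.ball 0 N,
    ⟨measurableSet_ball, Metric.isBounded_ball⟩, ⟨measurableSet_ball, Metric.isBounded_ball⟩,
    fun η h => if_neg h⟩
  · refine Measurable.ite ?_ measurable_const measurable_const
    exact ((measurableSet_subset hp measurableSet_ball).inter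
      ((measurable_card.comp hp) measurableSet_Iic)).inter
      ((measurableSet_subset hm measurableSet_ball).inter
      ((measurable_card.comp hm) measurableSet_Iic))
  · unfold cutoff
    split_ifs <;> simp

theorem exists_cutoff_eq_one (η : FinConf2 d) : ∃ N, cutoff d N η = 1 := by
  have hb : ∀ s : Finset (Pt d), ∃ R : ℝ, (s : Set (Pt d)) ⊆ Metric.ball 0 R := fun s =>
    s.finite_toSet.isBounded.subset_ball 0
  obtain ⟨R, hR⟩ := hb η.plus
  obtain ⟨S, hS⟩ := hb η.minus
  obtain ⟨M, hM⟩ := exists_nat_ge (max R S)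
  refine ⟨M + η.plus.card + η.minus.card, if_pos ⟨⟨hR.trans (Metric.ball_subset_ball ?_), by omega⟩,
    hS.trans (Metric.ball_subset_ball ?_), by omega⟩⟩
  · push_cast
    linarith [le_max_left R S, (Nat.cast_nonneg η.plus.card : (0 : ℝ) ≤ _),
      (Nat.cast_nonneg η.minus.card : (0 : ℝ) ≤ _)]
  · push_cast
    linarith [le_max_right R S, (Nat.cast_nonneg η.plus.card : (0 : ℝ) ≤ _),
      (Nat.cast_nonneg η.minus.card : (0 : ℝ) ≤ _)]

/-- Weighting by a cut-off makes the total integral finite, hence the inner integrals finite almost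
everywhere. Countably many cut-offs suffice, since at each `η` one of them equals `1`. -/
theorem ae_integrable_kernel (hd : 1 ≤ d) {κ : (Pt d × ConfPair d) × ConfPair d → ℝ}
    (hκ : Measurable κ)
    (hi : ∀ G : FinConf2 d → ℝ, IsBbs G → Integrable (weighted G κ) (kernelMeasure d)) :
    ∀ᵐ η ∂poissonProd d, ∀ x ∈ η.1.pts,
      Integrable (fun ζ => κ ((x, ⟨η.1.pts.erase x⟩, η.2), ζ)) (poissonProd d) := by
  have h : ∀ N : ℕ, ∀ᵐ η ∂poissonProd d, ∀ x ∈ η.1.pts, Integrable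
      (fun ζ => weighted (cutoff d N) κ ((x, ⟨η.1.pts.erase x⟩, η.2), ζ)) (poissonProd d) := by
    intro N
    have hm := measurable_weighted (isBbs_cutoff d N).measurable hκ
    have hI : Measurable fun p : Pt d × ConfPair d =>
        ∫⁻ ζ, ‖weighted (cutoff d N) κ (p, ζ)‖ₑ ∂poissonProd d := hm.enorm.lintegral_prod_right'
    have hfin : ∫⁻ p : Pt d × ConfPair d, ∫⁻ ζ, ‖weighted (cutoff d N) κ (p, ζ)‖ₑ ∂poissonProd d
        ∂(volume : Measure (Pt d)).prod (poissonProd d) ≠ ⊤ := by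
      rw [← lintegral_prod _ hm.enorm.aemeasurable]
      exact (hi _ (isBbs_cutoff d N)).2.ne
    rw [← lintegral_mecke_prod hd _ hI] at hfin
    filter_upwards [ae_lt_top (measurable_mecke_prod hI) hfin] with η hη x hx
    exact ⟨(hm.comp measurable_prodMk_left).aestronglyMeasurable,
      (ENNReal.sum_lt_top.1 hη x hx)⟩
  filter_upwards [ae_all_iff.2 h, ae_disjoint_prod hd] with η hη hdis x hx
  obtain ⟨N, hN⟩ := exists_cutoff_eq_one ⟨η, hdis⟩
  have := hη N x hx
  simp only [weighted_erase (cutoff d N) κ hx] at this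
  have h1 : onPair (cutoff d N) η.1.pts η.2.pts = 1 := (onPair_of_disjoint _ hdis).trans hN
  simpa only [h1, one_mul] using this

/-! ## The dual of `L̂₊` -/

theorem measurable_rateK {r : Pt d → FinConf2 d → ℝ} (hr : IsRate r) :
    Measurable fun p : (Pt d × ConfPair d) × ConfPair d =>
      rateK r p.1.1 p.1.2.1.pts p.1.2.2.pts p.2.1.pts p.2.2.pts := by
  have h0 := measurable_onPair_param hr.measurable
  have hcard : ∀ {Y : Type} [MeasurableSpace Y] {g g' : Y → FinConf d}, Measurable g →
      Measurable g' → Measurable fun y => ((g y).pts \ (g' y).pts).card := fun hg hg' =>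
    measurable_card.comp (measurable_sdiff hg hg')
  have h1 : Measurable fun q : (((Pt d × ConfPair d) × ConfPair d) × FinConf d) × FinConf d =>
      (-1 : ℝ) ^ ((q.1.1.2.1.pts \ q.1.2.pts).card + (q.1.1.2.2.pts \ q.2.pts).card) *
        onPair (r q.1.1.1.1) (q.1.2.pts ∪ q.1.1.1.2.1.pts) (q.2.pts ∪ q.1.1.1.2.2.pts) := by
    refine Measurable.mul ?_ ?_
    · exact (measurable_of_countable fun n : ℕ => (-1 : ℝ) ^ n).comp
        ((hcard (g := fun q : (((Pt d × ConfPair d) × ConfPair d) × FinConf d) × FinConf d =>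
          q.1.1.2.1) (g' := fun q => q.1.2) (by fun_prop) (by fun_prop)).add
        (hcard (g := fun q : (((Pt d × ConfPair d) × ConfPair d) × FinConf d) × FinConf d =>
          q.1.1.2.2) (g' := fun q => q.2) (by fun_prop) (by fun_prop)))
    · exact h0.comp (f := fun q : (((Pt d × ConfPair d) × ConfPair d) × FinConf d) × FinConf d =>
        (q.1.1.1.1, ((⟨q.1.2.pts ∪ q.1.1.1.2.1.pts⟩ : FinConf d),
          (⟨q.2.pts ∪ q.1.1.1.2.2.pts⟩ : FinConf d)))) (Measurable.prodMk (by fun_prop)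
        ((measurable_union (g := fun q : (((Pt d × ConfPair d) × ConfPair d) × FinConf d) ×
          FinConf d => q.1.2) (g' := fun q => q.1.1.1.2.1) (by fun_prop) (by fun_prop)).prodMk
        (measurable_union (g := fun q : (((Pt d × ConfPair d) × ConfPair d) × FinConf d) ×
          FinConf d => q.2) (g' := fun q => q.1.1.1.2.2) (by fun_prop) (by fun_prop))))
  have h2 := measurable_sum_powerset h1 (g := fun q : ((Pt d × ConfPair d) × ConfPair d) ×
    FinConf d => q.1.2.2) (by fun_prop)
  have h3 := measurable_sum_powerset h2 (g := fun q : (Pt d × ConfPair d) × ConfPair d =>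
    q.2.1) (by fun_prop)
  have hD : MeasurableSet {p : (Pt d × ConfPair d) × ConfPair d | Disjoint p.2.1.pts p.2.2.pts} :=
    measurable_snd measurableSet_disjointPairs
  convert Measurable.ite hD h3 (measurable_const (a := (0 : ℝ))) using 1
  funext p
  split_ifs with h
  · exact rateK_of_disjoint _ _ _ _ h
  · exact onPair_of_not_disjoint _ h
  · infer_instance

/-- The kernel of the death part of the dual. -/
def deathKernel (dp : Pt d → FinConf2 d → ℝ) (k : FinConf2 d → ℝ)
    (p : (Pt d × ConfPair d) × ConfPair d) : ℝ :=
  onPair k (insert p.1.1 p.1.2.1.pts ∪ p.2.1.pts) (p.1.2.2.pts ∪ p.2.2.pts) *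
    rateK dp p.1.1 p.1.2.1.pts p.1.2.2.pts p.2.1.pts p.2.2.pts

/-- The kernel of the birth part of the dual. -/
def birthKernel (bp : Pt d → FinConf2 d → ℝ) (k : FinConf2 d → ℝ)
    (p : (Pt d × ConfPair d) × ConfPair d) : ℝ :=
  onPair k (p.1.2.1.pts ∪ p.2.1.pts) (p.1.2.2.pts ∪ p.2.2.pts) *
    rateK bp p.1.1 p.1.2.1.pts p.1.2.2.pts p.2.1.pts p.2.2.pts

theorem measurable_deathKernel {dp : Pt d → FinConf2 d → ℝ} (hdp : IsRate dp)
    {k : FinConf2 d → ℝ} (hk : Measurable k) : Measurable (deathKernel dp k) := by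
  refine Measurable.mul (measurable_onPair hk
    (g := fun p : (Pt d × ConfPair d) × ConfPair d => ⟨insert p.1.1 p.1.2.1.pts ∪ p.2.1.pts⟩)
    (g' := fun p => ⟨p.1.2.2.pts ∪ p.2.2.pts⟩) ?_ ?_) (measurable_rateK hdp)
  · exact measurable_union (measurable_insert (f := fun p : (Pt d × ConfPair d) × ConfPair d =>
      p.1.1) (g := fun p => p.1.2.1) (by fun_prop) (by fun_prop)) (g' := fun p => p.2.1)
        (by fun_prop)
  · exact measurable_union (g := fun p : (Pt d × ConfPair d) × ConfPair d => p.1.2.2)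
      (g' := fun p => p.2.2) (by fun_prop) (by fun_prop)

theorem measurable_birthKernel {bp : Pt d → FinConf2 d → ℝ} (hbp : IsRate bp)
    {k : FinConf2 d → ℝ} (hk : Measurable k) : Measurable (birthKernel bp k) := by
  refine Measurable.mul (measurable_onPair hk
    (g := fun p : (Pt d × ConfPair d) × ConfPair d => ⟨p.1.2.1.pts ∪ p.2.1.pts⟩)
    (g' := fun p => ⟨p.1.2.2.pts ∪ p.2.2.pts⟩) ?_ ?_) (measurable_rateK hbp)
  · exact measurable_union (g := fun p : (Pt d × ConfPair d) × ConfPair d => p.1.2.1)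
      (g' := fun p => p.2.1) (by fun_prop) (by fun_prop)
  · exact measurable_union (g := fun p : (Pt d × ConfPair d) × ConfPair d => p.1.2.2)
      (g' := fun p => p.2.2) (by fun_prop) (by fun_prop)

/-- A subset and its complement reunite to `η`, so the argument of `k` no longer depends on the
splitting and `k η` factors out. -/
theorem weighted_deathKernel (dp : Pt d → FinConf2 d → ℝ) (G k : FinConf2 d → ℝ)
    {η : ConfPair d} {a b : Finset (Pt d)} (ha : a ∈ η.1.pts.powerset)
    (hb : b ∈ η.2.pts.powerset) {x : Pt d} (hx : x ∈ a) :
    weighted G (deathKernel dp k) ((x, ⟨a.erase x⟩, ⟨b⟩), (⟨η.1.pts \ a⟩, ⟨η.2.pts \ b⟩)) =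
      onPair G a b * (onPair k η.1.pts η.2.pts *
        rateK dp x (a.erase x) b (η.1.pts \ a) (η.2.pts \ b)) := by
  simp only [weighted, deathKernel, Finset.insert_erase hx,
    Finset.union_sdiff_of_subset (Finset.mem_powerset.1 ha),
    Finset.union_sdiff_of_subset (Finset.mem_powerset.1 hb)]

theorem weighted_birthKernel (bp : Pt d → FinConf2 d → ℝ) (G k : FinConf2 d → ℝ)
    {η : ConfPair d} {a b : Finset (Pt d)} (ha : a ∈ η.1.pts.powerset)
    (hb : b ∈ η.2.pts.powerset) (x : Pt d) :
    weighted G (birthKernel bp k) ((x, ⟨a⟩, ⟨b⟩), (⟨η.1.pts \ a⟩, ⟨η.2.pts \ b⟩)) =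
      onPair G (insert x a) b * (onPair k η.1.pts η.2.pts *
        rateK bp x a b (η.1.pts \ a) (η.2.pts \ b)) := by
  simp only [weighted, birthKernel,
    Finset.union_sdiff_of_subset (Finset.mem_powerset.1 ha),
    Finset.union_sdiff_of_subset (Finset.mem_powerset.1 hb)]

/-- At most `N` points in each component leave only `(N + 1)²` pairs of cardinalities, and the
hypothesis bounds the integral for each. -/
theorem lintegral_lt_top_of_confIn {Λ : Set (Pt d)} {I F : FinConf2 d → ℝ≥0∞}
    (hI : ∀ m n, ∫⁻ η in confIn Λ n m, I η ∂lebesguePoisson2 d < ⊤) (N : ℕ) {C : ℝ≥0∞}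
    (hC : C ≠ ⊤) (hF : ∀ η : FinConf2 d, F η ≠ 0 → (η.plus : Set (Pt d)) ⊆ Λ ∧
      (η.minus : Set (Pt d)) ⊆ Λ ∧ η.plus.card ≤ N ∧ η.minus.card ≤ N)
    (hle : ∀ η, F η ≤ C * I η) : ∫⁻ η, F η ∂lebesguePoisson2 d < ⊤ := by
  let S : Set (FinConf2 d) := ⋃ p : Fin (N + 1) × Fin (N + 1), confIn Λ p.1 p.2
  have h1 : ∀ η, F η ≤ S.indicator (fun η => C * I η) η := by
    intro η
    by_cases h0 : F η = 0
    · simp [h0]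
    · obtain ⟨h1, h2, h3, h4⟩ := hF η h0
      have : η ∈ S := Set.mem_iUnion.2 ⟨(⟨η.plus.card, by omega⟩, ⟨η.minus.card, by omega⟩),
        ⟨h1, rfl⟩, h2, rfl⟩
      rw [Set.indicator_of_mem this]
      exact hle η
  calc ∫⁻ η, F η ∂lebesguePoisson2 d
      ≤ ∫⁻ η in S, C * I η ∂lebesguePoisson2 d :=
        (lintegral_mono h1).trans (lintegral_indicator_le _ _)
    _ = C * ∫⁻ η in S, I η ∂lebesguePoisson2 d := lintegral_const_mul' _ _ hC
    _ < ⊤ := by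
        refine ENNReal.mul_lt_top hC.lt_top ((lintegral_iUnion_le _ _).trans_lt ?_)
        rw [tsum_fintype]
        exact ENNReal.sum_lt_top.2 fun p _ => hI _ _

theorem enorm_onPair_le {G : FinConf2 d → ℝ} {C : ℝ} (h : ∀ a b, |onPair G a b| ≤ C)
    (a b : Finset (Pt d)) : ‖onPair G a b‖ₑ ≤ ENNReal.ofReal C := by
  rw [Real.enorm_eq_ofReal_abs]
  exact ENNReal.ofReal_le_ofReal (h a b)

/-- Read back on $\Gamma_0^2$ by `lintegral_kernel_erase`, the integrand is dominated by the bounds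
of `G` and `k` times that of `Aplus`, with `Λ` and `N` supplied by the support of `k`. -/
theorem integrable_weighted_deathKernel (hd : 1 ≤ d) {dp bp : Pt d → FinConf2 d → ℝ}
    (hdp : IsRate dp)
    (hA : ∀ (Λ : Set (Pt d)) (m n : ℕ), IsBoundedBorel Λ → Aplus dp bp Λ m n < ⊤)
    {k : FinConf2 d → ℝ} (hk : IsBbs k) (G : FinConf2 d → ℝ) (hG : IsBbs G) :
    Integrable (weighted G (deathKernel dp k)) (kernelMeasure d) := by
  have hm := measurable_weighted hG.measurable (measurable_deathKernel hdp hk.measurable)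
  refine ⟨hm.aestronglyMeasurable, ?_⟩
  rw [hasFiniteIntegral_iff_enorm, ← lintegral_kernel_erase hd hm.enorm,
    ← (measurePreserving_val hd).lintegral_comp_emb measurableEmbedding_val]
  obtain ⟨Cg, -, -, -, -, hCg, -⟩ := hG.exists_bound
  obtain ⟨Ck, N, Λ, -, hΛ, hCk, hs⟩ := hk.exists_bound
  refine lintegral_lt_top_of_confIn (fun m n => hA Λ m n hΛ) N
    (C := ENNReal.ofReal Cg * ENNReal.ofReal Ck) (by finiteness) (fun η hη => ?_) fun η => ?_
  · have hk0 : onPair k η.plus η.minus ≠ 0 := by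
      intro h0
      refine hη (Finset.sum_eq_zero fun a ha => Finset.sum_eq_zero fun b hb =>
        Finset.sum_eq_zero fun x hx => ?_)
      rw [weighted_deathKernel dp G k ha hb hx, h0]
      simp
    exact (hs _ _ hk0).2
  · simp only [Finset.mul_sum]
    refine Finset.sum_le_sum fun a ha => Finset.sum_le_sum fun b hb => ?_
    -- Only the death summand of `Aplus` is needed here.
    refine le_trans ?_ (mul_le_mul_right le_self_add _)
    rw [Finset.mul_sum]
    refine Finset.sum_le_sum fun x hx => ?_
    rw [weighted_deathKernel dp G k ha hb hx, enorm_mul, enorm_mul, ← mul_assoc]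
    gcongr
    · exact enorm_onPair_le hCg _ _
    · exact enorm_onPair_le hCk _ _

theorem integrable_weighted_birthKernel (hd : 1 ≤ d) {dp bp : Pt d → FinConf2 d → ℝ}
    (hbp : IsRate bp)
    (hA : ∀ (Λ : Set (Pt d)) (m n : ℕ), IsBoundedBorel Λ → Aplus dp bp Λ m n < ⊤)
    {k : FinConf2 d → ℝ} (hk : IsBbs k) (G : FinConf2 d → ℝ) (hG : IsBbs G) :
    Integrable (weighted G (birthKernel bp k)) (kernelMeasure d) := by
  have hm := measurable_weighted hG.measurable (measurable_birthKernel hbp hk.measurable)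
  refine ⟨hm.aestronglyMeasurable, ?_⟩
  rw [hasFiniteIntegral_iff_enorm, ← lintegral_kernel_birth hd hm.enorm,
    ← (measurePreserving_val hd).lintegral_comp_emb measurableEmbedding_val]
  obtain ⟨Cg, Ng, Λg, -, hΛg, hCg, hsg⟩ := hG.exists_bound
  obtain ⟨Ck, N, Λk, -, hΛk, hCk, hs⟩ := hk.exists_bound
  -- The support of `k` bounds `η` but not the newborn point, which is confined by the support of
  -- `G`; a single `Λ` must serve both.
  have hΛ : IsBoundedBorel (Λg ∪ Λk) := ⟨hΛg.1.union hΛk.1, hΛg.2.union hΛk.2⟩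
  refine lintegral_lt_top_of_confIn (fun m n => hA (Λg ∪ Λk) m n hΛ) N
    (C := ENNReal.ofReal Cg * ENNReal.ofReal Ck) (by finiteness) (fun η hη => ?_) fun η => ?_
  · have hk0 : onPair k η.plus η.minus ≠ 0 := by
      intro h0
      refine hη (Finset.sum_eq_zero fun a ha => Finset.sum_eq_zero fun b hb => ?_)
      simp only [weighted_birthKernel bp G k ha hb, h0]
      simp
    obtain ⟨-, h1, h2, h3⟩ := hs _ _ hk0
    exact ⟨h1.trans Set.subset_union_right, h2.trans Set.subset_union_right, h3⟩
  · simp only [Finset.mul_sum]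
    refine Finset.sum_le_sum fun a ha => Finset.sum_le_sum fun b hb => ?_
    refine le_trans ?_ (mul_le_mul_right le_add_self _)
    rw [← lintegral_const_mul' _ _ (by finiteness)]
    refine le_trans (lintegral_mono fun x => ?_) (lintegral_indicator_le _ (Λg ∪ Λk))
    by_cases hx : x ∈ Λg ∪ Λk
    · rw [Set.indicator_of_mem hx, weighted_birthKernel bp G k ha hb, enorm_mul, enorm_mul,
        ← mul_assoc]
      gcongr
      · exact enorm_onPair_le hCg _ _
      · exact enorm_onPair_le hCk _ _
    · have : onPair G (insert x a) b = 0 := by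
        by_contra h
        exact hx (Or.inl ((hsg _ _ h).2.1 (by simp)))
      rw [weighted_birthKernel bp G k ha hb, this]
      simp

/-- The part of the dual that comes from `L₊`. -/
def plusFormula (dp bp : Pt d → FinConf2 d → ℝ) (k : FinConf2 d → ℝ) (η : FinConf2 d) : ℝ :=
  -(∑ x ∈ η.plus, ∫ ξ, deathPlus dp k η x ξ ∂(lebesguePoisson2 d))
    + ∑ x ∈ η.plus, ∫ ξ, birthPlus bp k η x ξ ∂(lebesguePoisson2 d)

theorem deathPlus_eq_kernel (dp : Pt d → FinConf2 d → ℝ) (k : FinConf2 d → ℝ) (η : FinConf2 d)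
    {x : Pt d} (hx : x ∈ η.plus) (ξ : FinConf2 d) :
    deathPlus dp k η x ξ = deathKernel dp k ((x, ⟨η.plus.erase x⟩, η.1.2), ξ.1) := by
  simp only [deathPlus, deathKernel, Finset.insert_erase hx]

theorem plusFormula_eq (hd : 1 ≤ d) (dp bp : Pt d → FinConf2 d → ℝ) (k : FinConf2 d → ℝ)
    (η : FinConf2 d) : plusFormula dp bp k η =
      -kernelSum (deathKernel dp k) η.1 + kernelSum (birthKernel bp k) η.1 := by
  have hc := fun f : ConfPair d → ℝ =>
    (measurePreserving_val hd).integral_comp measurableEmbedding_val f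
  unfold plusFormula kernelSum
  refine congrArg₂ (fun u v : ℝ => -u + v) ?_ ?_
  · refine Finset.sum_congr rfl fun x hx => ?_
    rw [← hc]
    simp only [deathPlus_eq_kernel dp k η hx]
  · refine Finset.sum_congr rfl fun x _ => ?_
    rw [← hc]
    rfl

theorem measurable_plusFormula (hd : 1 ≤ d) {dp bp : Pt d → FinConf2 d → ℝ} (hdp : IsRate dp)
    (hbp : IsRate bp) {k : FinConf2 d → ℝ} (hk : Measurable k) :
    Measurable (plusFormula dp bp k) := by
  rw [funext fun η => plusFormula_eq hd dp bp k η]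
  exact ((measurable_kernelSum (measurable_deathKernel hdp hk)).comp measurable_subtype_coe).neg.add
    ((measurable_kernelSum (measurable_birthKernel hbp hk)).comp measurable_subtype_coe)

theorem ae_integrable_plus (hd : 1 ≤ d) {dp bp : Pt d → FinConf2 d → ℝ} (hdp : IsRate dp)
    (hbp : IsRate bp)
    (hA : ∀ (Λ : Set (Pt d)) (m n : ℕ), IsBoundedBorel Λ → Aplus dp bp Λ m n < ⊤)
    {k : FinConf2 d → ℝ} (hk : IsBbs k) :
    ∀ᵐ η ∂lebesguePoisson2 d, ∀ x ∈ η.plus,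
      Integrable (deathPlus dp k η x) (lebesguePoisson2 d) ∧
      Integrable (birthPlus bp k η x) (lebesguePoisson2 d) := by
  have h1 := ae_integrable_kernel hd (measurable_deathKernel hdp hk.measurable)
    (integrable_weighted_deathKernel hd hdp hA hk)
  have h2 := ae_integrable_kernel hd (measurable_birthKernel hbp hk.measurable)
    (integrable_weighted_birthKernel hd hbp hA hk)
  have hq := (measurePreserving_val hd).quasiMeasurePreserving
  filter_upwards [hq.ae h1, hq.ae h2] with η hη1 hη2 x hx
  refine ⟨?_, (measurePreserving_val hd).integrable_comp_of_integrable (hη2 x hx)⟩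
  exact ((measurePreserving_val hd).integrable_comp_of_integrable (hη1 x hx)).congr
    (Filter.Eventually.of_forall fun ξ => (deathPlus_eq_kernel dp k η hx ξ).symm)

/-- Both pairings are compared through the integrals of the weighted death and birth kernels, to
which each side is equal term by term. -/
theorem duality_plus (hd : 1 ≤ d) {dp bp : Pt d → FinConf2 d → ℝ} (hdp : IsRate dp)
    (hbp : IsRate bp)
    (hA : ∀ (Λ : Set (Pt d)) (m n : ℕ), IsBoundedBorel Λ → Aplus dp bp Λ m n < ⊤)
    {k : FinConf2 d → ℝ} (hk : IsBbs k) {G : FinConf2 d → ℝ} (hG : IsBbs G) :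
    Integrable (fun η => Kinv (genPlus dp bp (Ktrans G)) η * k η) (lebesguePoisson2 d) ∧
    Integrable (fun η => G η * plusFormula dp bp k η) (lebesguePoisson2 d) ∧
    ∫ η, Kinv (genPlus dp bp (Ktrans G)) η * k η ∂lebesguePoisson2 d =
      ∫ η, G η * plusFormula dp bp k η ∂lebesguePoisson2 d := by
  have hmD := measurable_deathKernel hdp hk.measurable
  have hmB := measurable_birthKernel hbp hk.measurable
  have hiD := integrable_weighted_deathKernel hd hdp hA hk G hG
  have hiB := integrable_weighted_birthKernel hd hbp hA hk G hG
  obtain ⟨a1, a2⟩ := integral_kernel_erase hd (measurable_weighted hG.measurable hmD) hiD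
  obtain ⟨b1, b2⟩ := integral_kernel_birth hd (measurable_weighted hG.measurable hmB) hiB
  obtain ⟨c1, c2⟩ := integral_mul_kernelSum hd hmD hG.measurable hiD
  obtain ⟨e1, e2⟩ := integral_mul_kernelSum hd hmB hG.measurable hiB
  have hv := measurePreserving_val hd
  have hc := fun f : ConfPair d → ℝ => hv.integral_comp measurableEmbedding_val f
  rw [← hc] at a2 b2 c2 e2
  replace a1 := hv.integrable_comp_of_integrable a1
  replace b1 := hv.integrable_comp_of_integrable b1
  replace c1 := hv.integrable_comp_of_integrable c1
  replace e1 := hv.integrable_comp_of_integrable e1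
  have hL : (fun η : FinConf2 d => Kinv (genPlus dp bp (Ktrans G)) η * k η) = fun η =>
      -(∑ a ∈ η.1.1.pts.powerset, ∑ b ∈ η.1.2.pts.powerset, ∑ x ∈ a,
        weighted G (deathKernel dp k)
          ((x, ⟨a.erase x⟩, ⟨b⟩), (⟨η.1.1.pts \ a⟩, ⟨η.1.2.pts \ b⟩))) +
      ∑ a ∈ η.1.1.pts.powerset, ∑ b ∈ η.1.2.pts.powerset, ∫ x,
        weighted G (birthKernel bp k) ((x, ⟨a⟩, ⟨b⟩), (⟨η.1.1.pts \ a⟩, ⟨η.1.2.pts \ b⟩)) := by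
    funext η
    rw [Kinv_genPlus hd dp hbp hG, ← onPair_plus_minus k η, Finset.sum_mul,
      ← Finset.sum_neg_distrib, ← Finset.sum_add_distrib]
    refine Finset.sum_congr rfl fun a ha => ?_
    rw [Finset.sum_mul, ← Finset.sum_neg_distrib, ← Finset.sum_add_distrib]
    refine Finset.sum_congr rfl fun b hb => ?_
    rw [lhatPlus, add_mul, neg_mul, Finset.sum_mul, ← integral_mul_const]
    congr 2
    · refine Finset.sum_congr rfl fun x hx => ?_
      rw [weighted_deathKernel dp G k ha hb hx]
      ring
    · funext x
      rw [weighted_birthKernel bp G k ha hb]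
      ring
  have hR : (fun η : FinConf2 d => G η * plusFormula dp bp k η) = fun η =>
      -(onPair G η.1.1.pts η.1.2.pts * kernelSum (deathKernel dp k) η.1) +
        onPair G η.1.1.pts η.1.2.pts * kernelSum (birthKernel bp k) η.1 := by
    funext η
    rw [plusFormula_eq hd, ← onPair_plus_minus G η]
    ring
  rw [hL, hR]
  refine ⟨a1.neg.add b1, c1.neg.add e1, ?_⟩
  refine (integral_add a1.neg b1).trans (Eq.trans ?_ (integral_add c1.neg e1).symm)
  have f1 := (a2.trans c2.symm)
  have f2 := (b2.trans e2.symm)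
  exact congrArg₂ (· + ·) ((integral_neg _).trans ((congrArg Neg.neg f1).trans
    (integral_neg _).symm)) f2

/-! ## Exchanging the two components -/

/-- The exchange of the two components. -/
def swap2 (η : FinConf2 d) : FinConf2 d := ⟨η.1.swap, η.2.symm⟩

theorem swap2_swap2 (η : FinConf2 d) : swap2 (swap2 η) = η := rfl

theorem measurable_swap2 : Measurable (swap2 (d := d)) :=
  (measurable_swap.comp measurable_subtype_coe).subtype_mk

/-- The exchange of the two components, as a measurable equivalence. -/
def swapEquiv (d : ℕ) : FinConf2 d ≃ᵐ FinConf2 d where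
  toFun := swap2
  invFun := swap2
  left_inv := swap2_swap2
  right_inv := swap2_swap2
  measurable_toFun := measurable_swap2
  measurable_invFun := measurable_swap2

theorem measurableEmbedding_swap2 : MeasurableEmbedding (swap2 (d := d)) :=
  (swapEquiv d).measurableEmbedding

theorem measurePreserving_swap2 (hd : 1 ≤ d) :
    MeasurePreserving (swap2 (d := d)) (lebesguePoisson2 d) (lebesguePoisson2 d) := by
  refine ⟨measurable_swap2, ?_⟩
  have hv := measurePreserving_val hd
  -- A measure on $\Gamma_0^2$ is recovered from its image in the product, so invariance reduces to
  -- the symmetry of $\lambda\otimes\lambda$.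
  rw [← measurableEmbedding_val.comap_map (Measure.map swap2 (lebesguePoisson2 d)),
    Measure.map_map measurable_subtype_coe measurable_swap2]
  have : (Subtype.val ∘ swap2 : FinConf2 d → ConfPair d) = Prod.swap ∘ Subtype.val := rfl
  rw [this, ← Measure.map_map measurable_swap measurable_subtype_coe, hv.map_eq,
    Measure.prod_swap, ← hv.map_eq, measurableEmbedding_val.comap_map]

/-- A function on `Γ₀²`, with its two arguments exchanged. -/
def sw (G : FinConf2 d → ℝ) (η : FinConf2 d) : ℝ := G (swap2 η)

theorem onPair_sw (G : FinConf2 d → ℝ) (a b : Finset (Pt d)) :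
    onPair (sw G) a b = onPair G b a := by
  by_cases h : Disjoint a b
  · rw [onPair_of_disjoint _ h, onPair_of_disjoint _ h.symm]
    rfl
  · rw [onPair_of_not_disjoint _ h, onPair_of_not_disjoint _ fun h' => h h'.symm]

theorem Ktrans_sw (G : FinConf2 d → ℝ) : Ktrans (sw G) = sw (Ktrans G) := by
  funext η
  simp only [Ktrans, onPair_sw]
  exact Finset.sum_comm

theorem Kinv_sw (G : FinConf2 d → ℝ) : Kinv (sw G) = sw (Kinv G) := by
  funext η
  simp only [Kinv, onPair_sw]
  rw [Finset.sum_comm]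
  refine Finset.sum_congr rfl fun a _ => Finset.sum_congr rfl fun b _ => ?_
  rw [add_comm]
  rfl

/-- The conjugation that lets every statement about $L_-$ be deduced from the one about $L_+$ with
swapped rates. -/
theorem genMinus_eq_sw (dm bm : Pt d → FinConf2 d → ℝ) (F : FinConf2 d → ℝ) :
    genMinus dm bm F = sw (genPlus (fun x => sw (dm x)) (fun x => sw (bm x)) (sw F)) := by
  funext η
  simp only [genMinus, sw, genPlus]
  simp only [← sw.eq_def, onPair_sw]
  rfl

theorem rateK_sw (r : Pt d → FinConf2 d → ℝ) (x : Pt d) (a b c e : Finset (Pt d)) :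
    rateK (fun x => sw (r x)) x a b c e = rateK r x b a e c := by
  unfold rateK
  rw [← onPair_sw, ← Kinv_sw]
  congr 2
  funext ζ
  exact onPair_sw _ _ _

theorem IsRate.sw {r : Pt d → FinConf2 d → ℝ} (hr : IsRate r) :
    IsRate fun x => sw (r x) where
  nonneg x _ := hr.nonneg x _
  measurable := hr.measurable.comp (measurable_fst.prodMk (measurable_swap2.comp measurable_snd))
  locallyIntegrable _ := hr.locallyIntegrable _

theorem IsBbs.sw {G : FinConf2 d → ℝ} (hG : IsBbs G) : IsBbs (sw G) where
  measurable := hG.measurable.comp measurable_swap2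
  bounded := hG.bounded.imp fun _ h _ => h _
  bounded_support := by
    obtain ⟨Np, Nm, Λp, Λm, hp, hm, h⟩ := hG.bounded_support
    exact ⟨Nm, Np, Λm, Λp, hm, hp, fun η hη => h _ fun h' => hη h'.symm⟩

/-- The swap interchanges the two cardinalities, harmlessly, since finiteness is assumed for all `m`
and `n`. -/
theorem Aplus_sw (hd : 1 ≤ d) (dm bm : Pt d → FinConf2 d → ℝ) (Λ : Set (Pt d)) (m n : ℕ) :
    Aplus (fun x => sw (dm x)) (fun x => sw (bm x)) Λ m n = Aminus dm bm Λ n m := by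
  unfold Aplus Aminus
  rw [← (measurePreserving_swap2 hd).setLIntegral_comp_preimage_emb measurableEmbedding_swap2]
  have hs : swap2 ⁻¹' confIn Λ n m = confIn Λ m n := by
    ext η
    exact and_comm
  rw [hs]
  refine lintegral_congr fun η => ?_
  simp only [rateK_sw]
  exact Finset.sum_comm

/-- The part of the dual that comes from `L₋`. -/
def minusFormula (dm bm : Pt d → FinConf2 d → ℝ) (k : FinConf2 d → ℝ) (η : FinConf2 d) : ℝ :=
  -(∑ y ∈ η.minus, ∫ ξ, deathMinus dm k η y ξ ∂(lebesguePoisson2 d))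
    + ∑ y ∈ η.minus, ∫ ξ, birthMinus bm k η y ξ ∂(lebesguePoisson2 d)

theorem deathMinus_eq_sw (dm : Pt d → FinConf2 d → ℝ) (k : FinConf2 d → ℝ) (η : FinConf2 d)
    (y : Pt d) : deathMinus dm k η y =
      sw (deathPlus (fun x => sw (dm x)) (sw k) (swap2 η) y) := by
  funext ξ
  simp only [deathMinus, sw.eq_def (deathPlus _ _ _ _), deathPlus, rateK_sw, onPair_sw]
  rfl

theorem birthMinus_eq_sw (bm : Pt d → FinConf2 d → ℝ) (k : FinConf2 d → ℝ) (η : FinConf2 d)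
    (y : Pt d) : birthMinus bm k η y =
      sw (birthPlus (fun x => sw (bm x)) (sw k) (swap2 η) y) := by
  funext ξ
  simp only [birthMinus, sw.eq_def (birthPlus _ _ _ _), birthPlus, rateK_sw, onPair_sw]
  rfl

theorem integral_sw (hd : 1 ≤ d) (F : FinConf2 d → ℝ) :
    ∫ η, sw F η ∂lebesguePoisson2 d = ∫ η, F η ∂lebesguePoisson2 d :=
  (measurePreserving_swap2 hd).integral_comp measurableEmbedding_swap2 F

theorem integrable_sw (hd : 1 ≤ d) {F : FinConf2 d → ℝ} (hF : Integrable F (lebesguePoisson2 d)) :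
    Integrable (sw F) (lebesguePoisson2 d) :=
  (measurePreserving_swap2 hd).integrable_comp_of_integrable hF

theorem minusFormula_eq_sw (hd : 1 ≤ d) (dm bm : Pt d → FinConf2 d → ℝ) (k : FinConf2 d → ℝ) :
    minusFormula dm bm k = sw (plusFormula (fun x => sw (dm x)) (fun x => sw (bm x)) (sw k)) := by
  funext η
  simp only [minusFormula, deathMinus_eq_sw, birthMinus_eq_sw, integral_sw hd]
  rfl

theorem Aplus_sw_lt_top (hd : 1 ≤ d) {dm bm : Pt d → FinConf2 d → ℝ}
    (hA : ∀ (Λ : Set (Pt d)) (m n : ℕ), IsBoundedBorel Λ → Aminus dm bm Λ m n < ⊤)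
    (Λ : Set (Pt d)) (m n : ℕ) (hΛ : IsBoundedBorel Λ) :
    Aplus (fun x => sw (dm x)) (fun x => sw (bm x)) Λ m n < ⊤ := by
  rw [Aplus_sw hd]
  exact hA Λ n m hΛ

theorem ae_integrable_minus (hd : 1 ≤ d) {dm bm : Pt d → FinConf2 d → ℝ} (hdm : IsRate dm)
    (hbm : IsRate bm)
    (hA : ∀ (Λ : Set (Pt d)) (m n : ℕ), IsBoundedBorel Λ → Aminus dm bm Λ m n < ⊤)
    {k : FinConf2 d → ℝ} (hk : IsBbs k) :
    ∀ᵐ η ∂lebesguePoisson2 d, ∀ y ∈ η.minus,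
      Integrable (deathMinus dm k η y) (lebesguePoisson2 d) ∧
      Integrable (birthMinus bm k η y) (lebesguePoisson2 d) := by
  have h := ae_integrable_plus hd hdm.sw hbm.sw (Aplus_sw_lt_top hd hA) hk.sw
  filter_upwards [(measurePreserving_swap2 hd).quasiMeasurePreserving.ae h] with η hη y hy
  rw [deathMinus_eq_sw, birthMinus_eq_sw]
  exact ⟨integrable_sw hd (hη y hy).1, integrable_sw hd (hη y hy).2⟩

theorem duality_minus (hd : 1 ≤ d) {dm bm : Pt d → FinConf2 d → ℝ} (hdm : IsRate dm)
    (hbm : IsRate bm)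
    (hA : ∀ (Λ : Set (Pt d)) (m n : ℕ), IsBoundedBorel Λ → Aminus dm bm Λ m n < ⊤)
    {k : FinConf2 d → ℝ} (hk : IsBbs k) {G : FinConf2 d → ℝ} (hG : IsBbs G) :
    Integrable (fun η => Kinv (genMinus dm bm (Ktrans G)) η * k η) (lebesguePoisson2 d) ∧
    Integrable (fun η => G η * minusFormula dm bm k η) (lebesguePoisson2 d) ∧
    ∫ η, Kinv (genMinus dm bm (Ktrans G)) η * k η ∂lebesguePoisson2 d =
      ∫ η, G η * minusFormula dm bm k η ∂lebesguePoisson2 d := by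
  obtain ⟨h1, h2, h3⟩ :=
    duality_plus hd hdm.sw hbm.sw (Aplus_sw_lt_top hd hA) hk.sw hG.sw
  rw [genMinus_eq_sw, Kinv_sw, minusFormula_eq_sw hd, ← Ktrans_sw]
  refine ⟨integrable_sw hd h1, integrable_sw hd h2, ?_⟩
  exact (integral_sw hd _).trans (h3.trans (integral_sw hd _).symm)

/-! ## The dual operator -/

theorem Kinv_add (F₁ F₂ : FinConf2 d → ℝ) (η : FinConf2 d) :
    Kinv (fun γ => F₁ γ + F₂ γ) η = Kinv F₁ η + Kinv F₂ η := by
  simp only [Kinv, ← Finset.sum_add_distrib, ← mul_add]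
  refine Finset.sum_congr rfl fun a _ => Finset.sum_congr rfl fun b _ => ?_
  congr 1
  by_cases h : Disjoint a b
  · simp only [onPair_of_disjoint _ h]
  · simp only [onPair_of_not_disjoint _ h, add_zero]

theorem dualFormula_eq (dp dm bp bm : Pt d → FinConf2 d → ℝ) (k : FinConf2 d → ℝ)
    (η : FinConf2 d) :
    dualFormula dp dm bp bm k η = plusFormula dp bp k η + minusFormula dm bm k η := by
  unfold dualFormula plusFormula minusFormula
  ring

theorem isDualValue_dualFormula (hd : 1 ≤ d) {dp dm bp bm : Pt d → FinConf2 d → ℝ}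
    (hdp : IsRate dp) (hdm : IsRate dm) (hbp : IsRate bp) (hbm : IsRate bm)
    (hAp : ∀ (Λ : Set (Pt d)) (m n : ℕ), IsBoundedBorel Λ → Aplus dp bp Λ m n < ⊤)
    (hAm : ∀ (Λ : Set (Pt d)) (m n : ℕ), IsBoundedBorel Λ → Aminus dm bm Λ m n < ⊤)
    {k : FinConf2 d → ℝ} (hk : IsBbs k) :
    IsDualValue (Lhat dp dm bp bm) k (dualFormula dp dm bp bm k) := by
  constructor
  · rw [funext fun η => dualFormula_eq dp dm bp bm k η, minusFormula_eq_sw hd]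
    exact ((measurable_plusFormula hd hdp hbp hk.measurable).add
      ((measurable_plusFormula hd hdm.sw hbm.sw hk.sw.measurable).comp
        measurable_swap2)).aemeasurable
  · intro G hG
    obtain ⟨h1, h2, h3⟩ := duality_plus hd hdp hbp hAp hk hG
    obtain ⟨h4, h5, h6⟩ := duality_minus hd hdm hbm hAm hk hG
    have hL : (fun η => Lhat dp dm bp bm G η * k η) = fun η =>
        Kinv (genPlus dp bp (Ktrans G)) η * k η + Kinv (genMinus dm bm (Ktrans G)) η * k η := by
      funext η
      rw [← add_mul, ← Kinv_add]
      rfl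
    have hR : (fun η => G η * dualFormula dp dm bp bm k η) = fun η =>
        G η * plusFormula dp bp k η + G η * minusFormula dm bm k η := by
      funext η
      rw [dualFormula_eq, mul_add]
    rw [hL, hR]
    exact ⟨h1.add h4, h2.add h5, by rw [integral_add h1 h4, integral_add h2 h5, h3, h6]⟩

theorem IsBbs.indicator {G : FinConf2 d → ℝ} (hG : IsBbs G) {s : Set (FinConf2 d)}
    (hs : MeasurableSet s) : IsBbs (s.indicator G) where
  measurable := hG.measurable.indicator hs
  bounded := hG.bounded.imp fun _ h η =>
    (norm_indicator_le_norm_self (s := s) G η).trans (h η)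
  bounded_support := by
    obtain ⟨Np, Nm, Λp, Λm, hp, hm, h⟩ := hG.bounded_support
    exact ⟨Np, Nm, Λp, Λm, hp, hm, fun η hη => by simp [h η hη]⟩

/-- The operator plays no role: two values have the same pairing with every test function, and test
functions of the form cut-off times indicator determine a function almost everywhere. -/
theorem IsDualValue.ae_eq {T : (FinConf2 d → ℝ) → FinConf2 d → ℝ} {k h₁ h₂ : FinConf2 d → ℝ}
    (hh₁ : IsDualValue T k h₁) (hh₂ : IsDualValue T k h₂) : h₁ =ᵐ[lebesguePoisson2 d] h₂ := by
  have h : ∀ N : ℕ, (fun η => cutoff d N η * h₁ η) =ᵐ[lebesguePoisson2 d]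
      fun η => cutoff d N η * h₂ η := by
    intro N
    refine Integrable.ae_eq_of_forall_setIntegral_eq _ _ (hh₁.2 _ (isBbs_cutoff d N)).2.1
      (hh₂.2 _ (isBbs_cutoff d N)).2.1 fun s hs _ => ?_
    -- Restricting a cut-off to `s` stays in $B_{\mathrm{bs}}$, so the pairings yield equality of
    -- the integrals over `s`.
    have hG := (isBbs_cutoff d N).indicator hs
    have := (hh₁.2 _ hG).2.2.symm.trans (hh₂.2 _ hG).2.2
    rw [← integral_indicator hs, ← integral_indicator hs]
    simpa only [Set.indicator_mul_left] using this
  filter_upwards [ae_all_iff.2 h] with η hη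
  obtain ⟨N, hN⟩ := exists_cutoff_eq_one η
  simpa [hN] using hη N

end TwoComp

end

/-! ### The theorem -/

theorem mainTheorem2 (d : ℕ) (hd : 1 ≤ d)
    (dp dm bp bm : TwoComp.Pt d → TwoComp.FinConf2 d → ℝ)
    (hdp : TwoComp.IsRate dp) (hdm : TwoComp.IsRate dm)
    (hbp : TwoComp.IsRate bp) (hbm : TwoComp.IsRate bm)
    (hAp : ∀ (Λ : Set (TwoComp.Pt d)) (m n : ℕ), TwoComp.IsBoundedBorel Λ →
      TwoComp.Aplus dp bp Λ m n < ⊤)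
    (hAm : ∀ (Λ : Set (TwoComp.Pt d)) (m n : ℕ), TwoComp.IsBoundedBorel Λ →
      TwoComp.Aminus dm bm Λ m n < ⊤)
    (k : TwoComp.FinConf2 d → ℝ) (hk : TwoComp.IsBbs k) :
    -- almost everywhere, all the integrals in the formula exist
    (∀ᵐ η ∂(TwoComp.lebesguePoisson2 d),
      (∀ x ∈ η.plus,
        Integrable (TwoComp.deathPlus dp k η x) (TwoComp.lebesguePoisson2 d) ∧
        Integrable (TwoComp.birthPlus bp k η x) (TwoComp.lebesguePoisson2 d)) ∧
      (∀ y ∈ η.minus,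
        Integrable (TwoComp.deathMinus dm k η y) (TwoComp.lebesguePoisson2 d) ∧
        Integrable (TwoComp.birthMinus bm k η y) (TwoComp.lebesguePoisson2 d))) ∧
    -- the formula gives a value of the dual operator at `k`
    TwoComp.IsDualValue (TwoComp.Lhat dp dm bp bm) k (TwoComp.dualFormula dp dm bp bm k) ∧
    -- and every value of the dual operator at `k` is given by it almost everywhere
    (∀ h : TwoComp.FinConf2 d → ℝ, TwoComp.IsDualValue (TwoComp.Lhat dp dm bp bm) k h →
      h =ᵐ[TwoComp.lebesguePoisson2 d] TwoComp.dualFormula dp dm bp bm k) := by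
  have hdual := TwoComp.isDualValue_dualFormula hd hdp hdm hbp hbm hAp hAm hk
  refine ⟨?_, hdual, fun h hh => hh.ae_eq hdual⟩
  filter_upwards [TwoComp.ae_integrable_plus hd hdp hbp hAp hk,
    TwoComp.ae_integrable_minus hd hdm hbm hAm hk] with η h1 h2 using ⟨h1, h2⟩
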